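/- Let $\mathbb S^3$ be the group of unit quaternions and let $\mathbb S^2\subset\mathbb R^3$ be the unit sphere of pure quaternions, with surface measure $\omega_2$ of total mass $4\pi$. For $q\in\mathbb S^3$ and $h\in\mathbb S^2$, $qhq^*\in\mathbb S^2$ is the rotated vector. For $h,r\in\mathbb S^2$ let $C_{h,r}=\{p\in\mathbb S^3: php^*=r\}$, which is a great circle. For $f:\mathbb S^3\to\mathbb R$ define - the Radon transform $(\mathcal Rf)(C)=\frac1{2\pi}\int_C f\,d\omega_1$ (the mean value of $f$ over a great circle $C\subset\mathbb S^3$ with respect to arc length), and $(\mathcal Rf)(h,r)=(\mathcal Rf)(C_{h,r})$; - the angle density function $(\mathcal Af)(h,r;\theta)$, the mean value of $r'\mapsto(\mathcal Rf)(h,r')$ over the small circle $\{r'\in\mathbb S^2: r\cdot r'=\cos\theta\}$ with respect to arc length; thus $(\mathcal Af)(h,r;\theta)=\frac1{2\pi\sin\theta}\int_{r\cdot r'=\cos\theta}(\mathcal Rf)(h,r')\,dr'$ for $0<\theta<\pi$; - $(\mathcal T^{(\rho)}f)(q)$, the mean value of $f$ over the sphere in $\mathbb S^3$ with centre $q$ and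 geodesic radius $\rho$; - the dual generalized Radon transform $(\widetilde{\mathcal R}^{(\rho)}\varphi)(q)$ of a function $\varphi$ of great circles, its mean value over the great circles $C$ at geodesic distance $d(q,C)=\rho$ from $q$: $(\widetilde{\mathcal R}^{(\rho)}\varphi)(q)=\int\varphi(qkq^*C_0k^*)\,dk$, where $C_0$ is any great circle with $d(q,C_0)=\rho$ and $dk$ is normalized Haar measure on $\mathbb S^3$ (equivalently on $\mathbf{SO}(3)$). Let $f:\mathbb S^3\to\mathbb R$ be continuously differentiable and even, $f(-p)=f(p)$, and let $q\in\mathbb S^3$. Then: 1. For every great circle $C_0$ with $\rho=d(q,C_0)<\frac\pi2$, with $v=\cos\rho$, one has the Abel integral equation $$(\widetilde{\mathcal R}^{(\rho)}[\mathcal Rf])(q)=\frac2\pi\int_0^v\frac{(\mathcal T^{(\arccos u)}f)(q)}{\sqrt{v^2-u^2}}\,du ,$$ where the integral converges absolutely. 2. For every $h\in\mathbb S^2$ the function $\theta\mapsto(\mathcal Af)(h,qhq^*;\theta)$ is differentiable with respect to $\cos\theta$ for $0<\theta<\pi$; the functions $h\mapsto(\mathcal Rf)(h,-qhq^*)$ and,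 for $0<\theta<\pi$, $h\mapsto\frac{d}{d\cos\theta}(\mathcal Af)(h,qhq^*;\theta)$ are integrable over $\mathbb S^2$; the function $\theta\mapsto\cos\frac\theta2\int_{\mathbb S^2}\frac{d}{d\cos\theta}(\mathcal Af)(h,qhq^*;\theta)\,d\omega_2(h)$ is integrable over $[0,\pi]$; and $$f(q)=\frac1{4\pi}\left(\int_{\mathbb S^2}(\mathcal Rf)(h,-qhq^*)\,d\omega_2(h)+2\int_0^\pi\int_{\mathbb S^2}\frac{d}{d\cos\theta}\big((\mathcal Af)(h,qhq^*;\theta)\big)\,d\omega_2(h)\,\cos\tfrac\theta2\,d\theta\right).$$ -/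

import Mathlib

open Real MeasureTheory Metric Set
open scoped Quaternion Manifold RealInnerProductSpace

noncomputable section

/-! ## The spheres, their measures, and rotations -/

/-- The group of unit quaternions. -/
abbrev S3 : Type := sphere (0 : ℍ[ℝ]) 1

/-- The unit sphere of Euclidean three-space. -/
abbrev S2 : Type := sphere (0 : EuclideanSpace ℝ (Fin 3)) 1

instance factFinrankQuaternion : Fact (Module.finrank ℝ ℍ[ℝ] = 3 + 1) :=
  ⟨Quaternion.finrank_eq_four⟩

instance measurableSpaceQuaternion : MeasurableSpace ℍ[ℝ] := borel _

instance borelSpaceQuaternion : BorelSpace ℍ[ℝ] := ⟨rfl⟩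

/-- The surface measure of the two-sphere, of total mass `4π`. -/
def omega2 : Measure S2 := (volume : Measure (EuclideanSpace ℝ (Fin 3))).toSphere

/-- The normalized Haar measure on the unit quaternions. Its image under the double covering
is the normalized Haar measure of the rotation group. -/
def haarS3 : Measure S3 := Measure.haarMeasure ⊤

/-- Vectors of three-space as pure quaternions. -/
def pureQuat (x : EuclideanSpace ℝ (Fin 3)) : ℍ[ℝ] := ⟨0, x 0, x 1, x 2⟩

@[simp] theorem pureQuat_re (x : EuclideanSpace ℝ (Fin 3)) : (pureQuat x).re = 0 := rfl
@[simp] theorem pureQuat_imI (x : EuclideanSpace ℝ (Fin 3)) : (pureQuat x).imI = x 0 := rfl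
@[simp] theorem pureQuat_imJ (x : EuclideanSpace ℝ (Fin 3)) : (pureQuat x).imJ = x 1 := rfl
@[simp] theorem pureQuat_imK (x : EuclideanSpace ℝ (Fin 3)) : (pureQuat x).imK = x 2 := rfl

/-- The vector part of a quaternion. -/
def vecPart (p : ℍ[ℝ]) : EuclideanSpace ℝ (Fin 3) := !₂[p.imI, p.imJ, p.imK]

theorem norm_pureQuat (x : EuclideanSpace ℝ (Fin 3)) : ‖pureQuat x‖ = ‖x‖ := by
  have h : ‖pureQuat x‖ ^ 2 = ‖x‖ ^ 2 := by
    rw [EuclideanSpace.norm_sq_eq, sq, ← Quaternion.normSq_eq_norm_mul_self, Quaternion.normSq_def']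
    simp [Fin.sum_univ_three]
  exact (sq_eq_sq₀ (norm_nonneg _) (norm_nonneg _)).1 h

theorem pureQuat_vecPart {p : ℍ[ℝ]} (hp : p.re = 0) : pureQuat (vecPart p) = p := by
  ext <;> simp [pureQuat, vecPart, hp]

theorem vecPart_pureQuat (x : EuclideanSpace ℝ (Fin 3)) : vecPart (pureQuat x) = x := by
  ext i; fin_cases i <;> simp [pureQuat, vecPart]

theorem conj_re (q : ℍ[ℝ]) (x : EuclideanSpace ℝ (Fin 3)) :
    (q * pureQuat x * star q).re = 0 := by
  simp only [Quaternion.re_mul, Quaternion.imI_mul, Quaternion.imJ_mul, Quaternion.imK_mul,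
    Quaternion.re_star, Quaternion.imI_star, Quaternion.imJ_star, Quaternion.imK_star,
    pureQuat_re, pureQuat_imI, pureQuat_imJ, pureQuat_imK]
  ring

theorem norm_vecPart_conj (q : S3) (x : S2) :
    ‖vecPart ((q : ℍ[ℝ]) * pureQuat x * star (q : ℍ[ℝ]))‖ = 1 := by
  rw [← norm_pureQuat, pureQuat_vecPart (conj_re _ _), norm_mul, norm_mul, norm_star,
    norm_pureQuat, norm_eq_of_mem_sphere q, norm_eq_of_mem_sphere x]
  norm_num

/-- The rotated unit vector `q h q*`. -/
def rotate (q : S3) (h : S2) : S2 :=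
  ⟨vecPart ((q : ℍ[ℝ]) * pureQuat h * star (q : ℍ[ℝ])),
    mem_sphere_zero_iff_norm.2 (norm_vecPart_conj q h)⟩

/-! ## Circles and mean values over circles -/

/-- A centre `c` and two orthogonal vectors `a`, `b` of the same length, orthogonal to `c`,
such that the circle with centre `c` spanned by `a` and `b` lies on the unit sphere. The circle
may be reduced to a point. -/
structure CircleFrame (E : Type*) [NormedAddCommGroup E] [InnerProductSpace ℝ E] where
  c : E
  a : E
  b : E
  inner_ab : ⟪a, b⟫ = 0
  inner_ca : ⟪c, a⟫ = 0
  inner_cb : ⟪c, b⟫ = 0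
  norm_a : ‖c‖ ^ 2 + ‖a‖ ^ 2 = 1
  norm_b : ‖c‖ ^ 2 + ‖b‖ ^ 2 = 1

section Circle

variable {E : Type*} [NormedAddCommGroup E] [InnerProductSpace ℝ E]

theorem CircleFrame.norm_pt (γ : CircleFrame E) (t : ℝ) :
    ‖γ.c + (cos t • γ.a + sin t • γ.b)‖ = 1 := by
  have h : ‖γ.c + (cos t • γ.a + sin t • γ.b)‖ ^ 2 = 1 := by
    rw [norm_add_sq_real, norm_add_sq_real, inner_add_right]
    simp only [inner_smul_left, inner_smul_right, γ.inner_ab, γ.inner_ca, γ.inner_cb, norm_smul,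
      mul_pow, Real.norm_eq_abs, sq_abs]
    have h1 := γ.norm_a
    have h2 := γ.norm_b
    have h3 := sin_sq_add_cos_sq t
    linear_combination (1 - sin t ^ 2) * h1 + sin t ^ 2 * h2 + ‖γ.a‖ ^ 2 * h3
  nlinarith [norm_nonneg (γ.c + (cos t • γ.a + sin t • γ.b))]

/-- The parametrization of the circle by the angle. -/
def CircleFrame.pt (γ : CircleFrame E) (t : ℝ) : sphere (0 : E) 1 :=
  ⟨γ.c + (cos t • γ.a + sin t • γ.b), mem_sphere_zero_iff_norm.2 (γ.norm_pt t)⟩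

/-- The mean value of a function over a circle with respect to the angle, that is, with respect
to normalized arc length. -/
def CircleFrame.mean (γ : CircleFrame E) (F : sphere (0 : E) 1 → ℝ) : ℝ :=
  (2 * π)⁻¹ * ∫ t in (0 : ℝ)..2 * π, F (γ.pt t)

open Classical in
/-- The mean value of `F` over a circle given as a set, with respect to normalized arc length;
by `circleMean_range` any frame of the circle may be used to compute it. -/
def circleMean (C : Set (sphere (0 : E) 1)) (F : sphere (0 : E) 1 → ℝ) : ℝ :=
  if h : ∃ γ : CircleFrame E, range γ.pt = C then h.choose.mean F else 0

theorem CircleFrame.inner_c_pt (γ : CircleFrame E) (t : ℝ) :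
    ⟪γ.c, (γ.pt t : E)⟫ = ‖γ.c‖ ^ 2 := by
  simp [CircleFrame.pt, inner_add_right, inner_smul_right, γ.inner_ca, γ.inner_cb]

theorem CircleFrame.pt_add_pt (γ : CircleFrame E) :
    (γ.pt 0 : E) + γ.pt π = (2 : ℝ) • γ.c := by
  simp only [CircleFrame.pt, cos_zero, sin_zero, cos_pi, sin_pi]
  module

theorem CircleFrame.c_eq {γ δ : CircleFrame E} (h : range γ.pt = range δ.pt) : γ.c = δ.c := by
  have key : ∀ {γ δ : CircleFrame E}, range γ.pt = range δ.pt → ⟪γ.c, δ.c⟫ = ‖γ.c‖ ^ 2 := by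
    intro γ δ h
    have hm : ∀ t, ⟪γ.c, (δ.pt t : E)⟫ = ‖γ.c‖ ^ 2 := by
      intro t
      obtain ⟨s, hs⟩ : δ.pt t ∈ range γ.pt := h ▸ mem_range_self t
      rw [← hs, γ.inner_c_pt]
    have h2 := congrArg (fun x => ⟪γ.c, x⟫) δ.pt_add_pt
    simp only [inner_add_right, hm, inner_smul_right] at h2
    linarith
  have h1 := key h
  have h2 := key h.symm
  rw [real_inner_comm] at h2
  have h3 : ‖γ.c - δ.c‖ ^ 2 = 0 := by
    rw [norm_sub_sq_real]; linarith
  exact sub_eq_zero.1 (norm_eq_zero.1 (pow_eq_zero_iff (two_ne_zero)|>.1 h3))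

theorem CircleFrame.mean_eq {γ δ : CircleFrame E} (h : range γ.pt = range δ.pt)
    (F : sphere (0 : E) 1 → ℝ) : γ.mean F = δ.mean F := by
  have hc := CircleFrame.c_eq h
  have hper : Function.Periodic (fun t => F (γ.pt t)) (2 * π) := by
    intro t
    simp [CircleFrame.pt]
  -- an angle for each of the two spanning vectors
  have hang : ∀ t, ∃ s, cos t • δ.a + sin t • δ.b = cos s • γ.a + sin s • γ.b := by
    intro t
    obtain ⟨s, hs⟩ : δ.pt t ∈ range γ.pt := h ▸ mem_range_self t
    refine ⟨s, ?_⟩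
    have := congrArg Subtype.val hs
    simp only [CircleFrame.pt, hc] at this
    exact (add_left_cancel this).symm
  obtain ⟨s, hs⟩ := hang 0
  obtain ⟨s', hs'⟩ := hang (π / 2)
  simp only [cos_zero, sin_zero, one_smul, zero_smul, add_zero, cos_pi_div_two, sin_pi_div_two,
    zero_add] at hs hs'
  have hR : ‖γ.b‖ ^ 2 = ‖γ.a‖ ^ 2 := by linarith [γ.norm_a, γ.norm_b]
  by_cases h0 : γ.a = 0
  · have hb : γ.b = 0 := by
      rw [h0] at hR
      simpa using hR
    simp only [CircleFrame.mean]
    congr 2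
    ext t
    congr 1
    ext1
    simp [CircleFrame.pt, hc, hs, hs', h0, hb]
  have hpos : ‖γ.a‖ ^ 2 ≠ 0 := by simpa using h0
  have hcs : cos (s' - s) = 0 := by
    have h1 := δ.inner_ab
    rw [hs, hs'] at h1
    have hba : ⟪γ.b, γ.a⟫ = 0 := by rw [real_inner_comm]; exact γ.inner_ab
    simp only [inner_add_left, inner_add_right, inner_smul_left, inner_smul_right, γ.inner_ab, hba,
      real_inner_self_eq_norm_sq, hR, mul_zero, add_zero, zero_add, conj_trivial] at h1
    rw [cos_sub]
    have : ‖γ.a‖ ^ 2 * (cos s' * cos s + sin s' * sin s) = 0 := by linarith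
    exact (mul_eq_zero.1 this).resolve_left hpos
  set e := sin (s' - s) with he
  have hcos' : cos s' = -(e * sin s) := by
    have : s' = s + (s' - s) := by ring
    rw [this, cos_add, hcs, ← he]; ring
  have hsin' : sin s' = e * cos s := by
    have : s' = s + (s' - s) := by ring
    rw [this, sin_add, hcs, ← he]; ring
  have he2 : e = 1 ∨ e = -1 := by
    have h1 := sin_sq_add_cos_sq (s' - s)
    rw [hcs, ← he] at h1
    have h2 : (e - 1) * (e + 1) = 0 := by linarith
    rcases mul_eq_zero.1 h2 with h | h
    · left; linarith
    · right; linarith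
  have hI : (∫ t in (0 : ℝ)..2 * π, F (γ.pt t)) = ∫ t in s..s + 2 * π, F (γ.pt t) := by
    have := hper.intervalIntegral_add_eq 0 s
    simpa using this
  simp only [CircleFrame.mean]
  congr 1
  rcases he2 with h1 | h1
  · have hpt : ∀ t, δ.pt t = γ.pt (t + s) := by
      intro t
      ext1
      simp only [CircleFrame.pt, hc, hs, hs', hcos', hsin', h1, cos_add, sin_add]
      module
    simp only [hpt]
    rw [intervalIntegral.integral_comp_add_right (fun t => F (γ.pt t)), hI]
    congr 1 <;> ring
  · have hpt : ∀ t, δ.pt t = γ.pt (s - t) := by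
      intro t
      ext1
      simp only [CircleFrame.pt, hc, hs, hs', hcos', hsin', h1, cos_sub, sin_sub]
      module
    simp only [hpt]
    have hJ : (∫ t in (0 : ℝ)..2 * π, F (γ.pt t)) =
        ∫ t in s - 2 * π..s - 2 * π + 2 * π, F (γ.pt t) := by
      have := hper.intervalIntegral_add_eq 0 (s - 2 * π)
      simpa using this
    rw [intervalIntegral.integral_comp_sub_left (fun t => F (γ.pt t)), hJ]
    congr 1 <;> ring

theorem circleMean_range (γ : CircleFrame E) (F : sphere (0 : E) 1 → ℝ) :
    circleMean (range γ.pt) F = γ.mean F := by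
  have h : ∃ δ : CircleFrame E, range δ.pt = range γ.pt := ⟨γ, rfl⟩
  rw [circleMean, dif_pos h]
  exact CircleFrame.mean_eq h.choose_spec F

end Circle

/-! ## Great circles of the three-sphere, small circles of the two-sphere -/

/-- The great circle `{q₁ cos t + q₂ sin t}`. -/
def greatCircle (q₁ q₂ : S3) : Set S3 :=
  {p | ∃ t : ℝ, (p : ℍ[ℝ]) = cos t • (q₁ : ℍ[ℝ]) + sin t • (q₂ : ℍ[ℝ])}

/-- Great circles: spanned by two orthogonal unit quaternions. -/
def IsGreatCircle (C : Set S3) : Prop :=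
  ∃ q₁ q₂ : S3, ⟪(q₁ : ℍ[ℝ]), (q₂ : ℍ[ℝ])⟫ = 0 ∧ C = greatCircle q₁ q₂

/-- The great circle `C_{h,r}` of all unit quaternions `p` with `p h p* = r`. -/
def fibre (h r : S2) : Set S3 := {p | rotate p h = r}

/-- The small circle with centre `r` and angle `ρ`. -/
def smallCircle (r : S2) (ρ : ℝ) : Set S2 :=
  {r' | ⟪(r : EuclideanSpace ℝ (Fin 3)), (r' : EuclideanSpace ℝ (Fin 3))⟫ = cos ρ}

/-- Geodesic distance of a point from a subset of the three-sphere. -/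
def distS3 (q : S3) (C : Set S3) : ℝ :=
  sInf ((fun p : S3 => arccos ⟪(q : ℍ[ℝ]), (p : ℍ[ℝ])⟫) '' C)

/-! ## The transforms -/

/-- The one-dimensional spherical Radon transform: the mean value of `f` over a great circle. -/
def radon (f : S3 → ℝ) (C : Set S3) : ℝ := circleMean C f

/-- The angle density function `(𝒜f)(h, r; ρ)`: the mean value of `r' ↦ (ℛf)(h, r')` over
the small circle with centre `r` and angle `ρ`. -/
def angleDensity (f : S3 → ℝ) (h r : S2) (ρ : ℝ) : ℝ :=
  circleMean (smallCircle r ρ) (fun r' => radon f (fibre h r'))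

/-- The frame of a great circle. -/
def greatFrame (q₁ q₂ : S3) (h : ⟪(q₁ : ℍ[ℝ]), (q₂ : ℍ[ℝ])⟫ = 0) : CircleFrame ℍ[ℝ] where
  c := 0
  a := q₁
  b := q₂
  inner_ab := h
  inner_ca := inner_zero_left _
  inner_cb := inner_zero_left _
  norm_a := by simp
  norm_b := by simp

theorem range_greatFrame (q₁ q₂ : S3) (h : ⟪(q₁ : ℍ[ℝ]), (q₂ : ℍ[ℝ])⟫ = 0) :
    range (greatFrame q₁ q₂ h).pt = greatCircle q₁ q₂ := by
  ext p
  simp only [mem_range, greatCircle, mem_ofPred_eq, Subtype.ext_iff, CircleFrame.pt, greatFrame,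
    zero_add]
  exact exists_congr fun t => eq_comm

/-- The mean value over `{q₁ cos t + q₂ sin t}` is the mean value over `0 ≤ t ≤ 2π`. -/
theorem radon_greatCircle (f : S3 → ℝ) (q₁ q₂ : S3) (h : ⟪(q₁ : ℍ[ℝ]), (q₂ : ℍ[ℝ])⟫ = 0) :
    radon f (greatCircle q₁ q₂) =
      (2 * π)⁻¹ * ∫ t in (0 : ℝ)..2 * π, f ((greatFrame q₁ q₂ h).pt t) := by
  rw [radon, ← range_greatFrame q₁ q₂ h, circleMean_range, CircleFrame.mean]

theorem pureQuat_rotate (q : S3) (h : S2) :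
    pureQuat (rotate q h) = (q : ℍ[ℝ]) * pureQuat h * star (q : ℍ[ℝ]) :=
  pureQuat_vecPart (conj_re _ _)

theorem pureQuat_injective : Function.Injective pureQuat :=
  Function.LeftInverse.injective vecPart_pureQuat

theorem star_mul_self_S3 (p : S3) : star (p : ℍ[ℝ]) * p = 1 := by
  rw [Quaternion.star_mul_self, Quaternion.normSq_eq_norm_mul_self, norm_eq_of_mem_sphere p]
  simp

theorem mem_fibre (h r : S2) (p : S3) :
    p ∈ fibre h r ↔ (p : ℍ[ℝ]) * pureQuat h = pureQuat r * p := by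
  have h2 : (p : ℍ[ℝ]) * star (p : ℍ[ℝ]) = 1 := by
    rw [Quaternion.self_mul_star, Quaternion.normSq_eq_norm_mul_self, norm_eq_of_mem_sphere p]
    simp
  have h3 : p ∈ fibre h r ↔ pureQuat (rotate p h) = pureQuat r := by
    rw [fibre, mem_ofPred_eq, Subtype.ext_iff]
    exact pureQuat_injective.eq_iff.symm
  rw [h3, pureQuat_rotate]
  constructor
  · intro hp
    rw [← hp, mul_assoc _ (star _), star_mul_self_S3, mul_one]
  · intro hp
    rw [hp, mul_assoc, h2, mul_one]

theorem pureQuat_mul_self (h : S2) : pureQuat h * pureQuat h = -1 := by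
  have h1 : pureQuat h * star (pureQuat h) = 1 := by
    rw [Quaternion.self_mul_star, Quaternion.normSq_eq_norm_mul_self, norm_pureQuat,
      norm_eq_of_mem_sphere h]
    simp
  have h2 : star (pureQuat h) = -pureQuat h := by ext <;> simp
  rw [h2, mul_neg] at h1
  rw [← h1, neg_neg]

theorem exists_cos_sin {x y : ℝ} (h : x ^ 2 + y ^ 2 = 1) : ∃ t : ℝ, cos t = x ∧ sin t = y := by
  have hn : ‖(⟨x, y⟩ : ℂ)‖ = 1 := by
    rw [← sq_eq_sq₀ (norm_nonneg _) zero_le_one, Complex.sq_norm, Complex.normSq_mk]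
    linarith
  have h0 : (⟨x, y⟩ : ℂ) ≠ 0 := by
    intro h0
    rw [h0, norm_zero] at hn
    exact zero_ne_one hn
  exact ⟨Complex.arg ⟨x, y⟩, by rw [Complex.cos_arg h0, hn, div_one],
    by rw [Complex.sin_arg, hn, div_one]⟩

theorem fibre_nonempty (h r : S2) : (fibre h r).Nonempty := by
  -- a nonzero solution of `p h = r p` can be normalized
  have key : ∀ x : ℍ[ℝ], x ≠ 0 → x * pureQuat h = pureQuat r * x → (fibre h r).Nonempty := by
    intro x hx hxe
    refine ⟨⟨‖x‖⁻¹ • x, ?_⟩, ?_⟩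
    · rw [mem_sphere_zero_iff_norm, norm_smul, norm_inv, norm_norm,
        inv_mul_cancel₀ (norm_ne_zero_iff.2 hx)]
    · rw [mem_fibre]
      simp only [smul_mul_assoc, mul_smul_comm, hxe]
  by_cases h0 : 1 - pureQuat r * pureQuat h = 0
  · have hr : pureQuat r = -pureQuat h := by
      have h1 : pureQuat r * pureQuat h = 1 := (sub_eq_zero.1 h0).symm
      have h2 := congrArg (fun x => x * pureQuat h) h1
      simp only [mul_assoc, pureQuat_mul_self, one_mul, mul_neg, mul_one] at h2
      rw [← h2, neg_neg]
    by_cases h01 : (h : EuclideanSpace ℝ (Fin 3)) 0 = 0 ∧ (h : EuclideanSpace ℝ (Fin 3)) 1 = 0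
    · refine key (pureQuat !₂[1, 0, 0]) (fun hx => ?_) ?_
      · simpa using congrArg (fun x => x.imI) hx
      · rw [hr]
        ext <;> simp only [Quaternion.re_mul, Quaternion.imI_mul, Quaternion.imJ_mul, Quaternion.imK_mul,
          Quaternion.re_neg, Quaternion.imI_neg, Quaternion.imJ_neg, Quaternion.imK_neg,
          pureQuat_re, pureQuat_imI, pureQuat_imJ, pureQuat_imK, h01.1] <;> simp
    · refine key (pureQuat !₂[-(h : EuclideanSpace ℝ (Fin 3)) 1, (h : EuclideanSpace ℝ (Fin 3)) 0, 0])
        (fun hx => h01 ⟨?_, ?_⟩) ?_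
      · simpa using congrArg (fun x => x.imJ) hx
      · simpa using congrArg (fun x => x.imI) hx
      · rw [hr]
        ext <;> simp only [Quaternion.re_mul, Quaternion.imI_mul, Quaternion.imJ_mul, Quaternion.imK_mul,
          Quaternion.re_neg, Quaternion.imI_neg, Quaternion.imJ_neg, Quaternion.imK_neg,
          pureQuat_re, pureQuat_imI, pureQuat_imJ, pureQuat_imK] <;> simp <;> ring
  · refine key _ h0 ?_
    rw [sub_mul, mul_sub, mul_assoc, pureQuat_mul_self, ← mul_assoc, pureQuat_mul_self]
    simp only [one_mul, mul_one, mul_neg, neg_mul]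
    abel

/-- `C_{h,r}` is a great circle. -/
theorem isGreatCircle_fibre (h r : S2) : IsGreatCircle (fibre h r) := by
  obtain ⟨p, hp⟩ := fibre_nonempty h r
  have hp' := (mem_fibre h r p).1 hp
  have hn : ‖(p : ℍ[ℝ]) * pureQuat h‖ = 1 := by
    rw [norm_mul, norm_pureQuat, norm_eq_of_mem_sphere p, norm_eq_of_mem_sphere h, one_mul]
  refine ⟨p, ⟨(p : ℍ[ℝ]) * pureQuat h, mem_sphere_zero_iff_norm.2 hn⟩, ?_, ?_⟩
  · rw [Quaternion.inner_def]
    simp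
    ring
  · ext x
    rw [mem_fibre]
    constructor
    · intro hx
      -- `y = p* x` commutes with `h`
      set y : ℍ[ℝ] := star (p : ℍ[ℝ]) * x with hy
      have hcomm : y * pureQuat h = pureQuat h * y := by
        have h1 : star (p : ℍ[ℝ]) * pureQuat r = pureQuat h * star (p : ℍ[ℝ]) := by
          have h2 := congrArg star hp'
          have h3 : ∀ z : S2, star (pureQuat z) = -pureQuat z := fun z => by ext <;> simp
          rw [star_mul, star_mul, h3, h3] at h2
          simpa using h2.symm
        rw [hy, mul_assoc, hx, ← mul_assoc, h1, mul_assoc]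
      have hxy : (x : ℍ[ℝ]) = p * y := by
        have h1 : (p : ℍ[ℝ]) * star (p : ℍ[ℝ]) = 1 := by
          rw [Quaternion.self_mul_star, Quaternion.normSq_eq_norm_mul_self, norm_eq_of_mem_sphere p]
          simp
        rw [hy, ← mul_assoc, h1, one_mul]
      have hny : ‖y‖ = 1 := by
        rw [hy, norm_mul, norm_star, norm_eq_of_mem_sphere p, norm_eq_of_mem_sphere x, one_mul]
      have hh : ‖pureQuat h‖ = 1 := by rw [norm_pureQuat, norm_eq_of_mem_sphere h]
      clear_value y
      have hny2 := congrArg (fun z => z * z) hny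
      have hh2 := congrArg (fun z => z * z) hh
      simp only [← Quaternion.normSq_eq_norm_mul_self, Quaternion.normSq_def', pureQuat_re,
        pureQuat_imI, pureQuat_imJ, pureQuat_imK, mul_one] at hny2 hh2
      have e1 := congrArg (fun z => z.imI) hcomm
      have e2 := congrArg (fun z => z.imJ) hcomm
      have e3 := congrArg (fun z => z.imK) hcomm
      simp only [Quaternion.imI_mul, Quaternion.imJ_mul, Quaternion.imK_mul,
        pureQuat_re, pureQuat_imI, pureQuat_imJ, pureQuat_imK] at e1 e2 e3
      set h0 := (h : EuclideanSpace ℝ (Fin 3)) 0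
      set h1 := (h : EuclideanSpace ℝ (Fin 3)) 1
      set h2 := (h : EuclideanSpace ℝ (Fin 3)) 2
      set l := y.imI * h0 + y.imJ * h1 + y.imK * h2 with hl
      have f1 : y.imI = l * h0 := by
        rw [hl]; linear_combination -y.imI * hh2 + h1 / 2 * e3 - h2 / 2 * e2
      have f2 : y.imJ = l * h1 := by
        rw [hl]; linear_combination -y.imJ * hh2 + h2 / 2 * e1 - h0 / 2 * e3
      have f3 : y.imK = l * h2 := by
        rw [hl]; linear_combination -y.imK * hh2 + h0 / 2 * e2 - h1 / 2 * e1
      clear_value l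
      have hyl : y = (y.re : ℍ[ℝ]) + l • pureQuat h := by
        ext <;> simp only [Quaternion.re_add, Quaternion.imI_add, Quaternion.imJ_add,
          Quaternion.imK_add, Quaternion.re_smul, Quaternion.imI_smul, Quaternion.imJ_smul,
          Quaternion.imK_smul, Quaternion.re_coe, Quaternion.imI_coe, Quaternion.imJ_coe,
          Quaternion.imK_coe, pureQuat_re, pureQuat_imI, pureQuat_imJ, pureQuat_imK,
          smul_eq_mul, mul_zero, add_zero, zero_add, f1, f2, f3, h0, h1, h2]
      rw [f1, f2, f3] at hny2
      obtain ⟨t, ht1, ht2⟩ := exists_cos_sin (x := y.re) (y := l)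
        (by linear_combination hny2 - l ^ 2 * hh2)
      refine ⟨t, ?_⟩
      rw [hxy, ht1, ht2, hyl, mul_add, mul_smul_comm, ← Quaternion.coe_commutes,
        Quaternion.coe_mul_eq_smul]
      simp
    · rintro ⟨t, ht⟩
      rw [ht]
      simp only [add_mul, mul_add, smul_mul_assoc, mul_smul_comm]
      rw [← mul_assoc (pureQuat r), hp']

/-- The small circle `c(r; ρ)` is a circle. -/
theorem exists_frame_smallCircle (r : S2) (ρ : ℝ) :
    ∃ γ : CircleFrame (EuclideanSpace ℝ (Fin 3)), γ.c = cos ρ • (r : EuclideanSpace ℝ (Fin 3)) ∧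
      range γ.pt = smallCircle r ρ := by
  set W := (ℝ ∙ (r : EuclideanSpace ℝ (Fin 3)))ᗮ with hW
  have hr0 : (r : EuclideanSpace ℝ (Fin 3)) ≠ 0 := ne_zero_of_mem_unit_sphere r
  have hr1 : ‖(r : EuclideanSpace ℝ (Fin 3))‖ = 1 := norm_eq_of_mem_sphere r
  have : Fact (Module.finrank ℝ (EuclideanSpace ℝ (Fin 3)) = 2 + 1) := ⟨by simp⟩
  have hfr : Module.finrank ℝ W = 2 := Submodule.finrank_orthogonal_span_singleton hr0
  let b : OrthonormalBasis (Fin 2) ℝ W := (stdOrthonormalBasis ℝ W).reindex (finCongr hfr)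
  have hrb : ∀ w : W, ⟪(r : EuclideanSpace ℝ (Fin 3)), (w : EuclideanSpace ℝ (Fin 3))⟫ = 0 :=
    fun w => Submodule.mem_orthogonal_singleton_iff_inner_right.1 w.2
  have hb01 : ⟪(b 0 : EuclideanSpace ℝ (Fin 3)), (b 1 : EuclideanSpace ℝ (Fin 3))⟫ = 0 :=
    b.orthonormal.2 (by decide)
  have hbn : ∀ i, ‖(b i : EuclideanSpace ℝ (Fin 3))‖ = 1 := fun i => b.orthonormal.1 i
  let γ : CircleFrame (EuclideanSpace ℝ (Fin 3)) :=
    { c := cos ρ • (r : EuclideanSpace ℝ (Fin 3))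
      a := sin ρ • (b 0 : EuclideanSpace ℝ (Fin 3))
      b := sin ρ • (b 1 : EuclideanSpace ℝ (Fin 3))
      inner_ab := by rw [real_inner_smul_left, real_inner_smul_right, hb01]; simp
      inner_ca := by rw [real_inner_smul_left, real_inner_smul_right, hrb]; simp
      inner_cb := by rw [real_inner_smul_left, real_inner_smul_right, hrb]; simp
      norm_a := by simp [norm_smul, hr1, hbn]
      norm_b := by simp [norm_smul, hr1, hbn] }
  refine ⟨γ, rfl, ?_⟩
  ext x
  constructor
  · rintro ⟨t, rfl⟩
    simp [smallCircle, CircleFrame.pt, γ, inner_add_right, real_inner_smul_right, hrb, hr1]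
  · intro hx
    change ⟪(r : EuclideanSpace ℝ (Fin 3)), (x : EuclideanSpace ℝ (Fin 3))⟫ = cos ρ at hx
    have hw : (x : EuclideanSpace ℝ (Fin 3)) - cos ρ • (r : EuclideanSpace ℝ (Fin 3)) ∈ W := by
      rw [hW, Submodule.mem_orthogonal_singleton_iff_inner_right, inner_sub_right,
        real_inner_smul_right, real_inner_self_eq_norm_sq, hr1, hx]
      ring
    set w : W := ⟨_, hw⟩ with hwdef
    have hwx : (x : EuclideanSpace ℝ (Fin 3)) =
        cos ρ • (r : EuclideanSpace ℝ (Fin 3)) + (w : EuclideanSpace ℝ (Fin 3)) := by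
      simp [hwdef]
    have hsum : (w : EuclideanSpace ℝ (Fin 3)) =
        ⟪b 0, w⟫ • (b 0 : EuclideanSpace ℝ (Fin 3)) +
          ⟪b 1, w⟫ • (b 1 : EuclideanSpace ℝ (Fin 3)) := by
      have h1 := congrArg (fun z : W => (z : EuclideanSpace ℝ (Fin 3))) (b.sum_repr' w)
      simpa [Fin.sum_univ_two] using h1.symm
    set X := ⟪b 0, w⟫
    set Y := ⟪b 1, w⟫
    clear_value X Y
    have hnorm : X ^ 2 + Y ^ 2 = sin ρ ^ 2 := by
      have h1 : ‖(x : EuclideanSpace ℝ (Fin 3))‖ ^ 2 = 1 := by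
        rw [norm_eq_of_mem_sphere x, one_pow]
      rw [hwx, norm_add_sq_real, real_inner_smul_left, hrb, hsum, norm_add_sq_real,
        real_inner_smul_left, real_inner_smul_right, hb01, norm_smul, norm_smul, norm_smul,
        hbn, hbn, hr1] at h1
      simp only [mul_one, mul_zero, add_zero, Real.norm_eq_abs, sq_abs] at h1
      linarith [sin_sq_add_cos_sq ρ]
    have ht : ∃ t : ℝ, sin ρ * cos t = X ∧ sin ρ * sin t = Y := by
      by_cases hs : sin ρ = 0
      · rw [hs] at hnorm ⊢
        exact ⟨0, by nlinarith [sq_nonneg X, sq_nonneg Y], by nlinarith [sq_nonneg X, sq_nonneg Y]⟩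
      · obtain ⟨t, h1, h2⟩ := exists_cos_sin (x := X / sin ρ) (y := Y / sin ρ)
          (by rw [div_pow, div_pow, ← add_div, hnorm, div_self (pow_ne_zero 2 hs)])
        exact ⟨t, by rw [h1]; field_simp, by rw [h2]; field_simp⟩
    obtain ⟨t, h1, h2⟩ := ht
    refine ⟨t, ?_⟩
    ext1
    rw [hwx, hsum, ← h1, ← h2]
    simp only [CircleFrame.pt, γ, smul_smul, mul_comm]

/-- The derivative of `θ ↦ (𝒜f)(h, r; θ)` with respect to `cos θ`, for `0 ≤ θ ≤ π`. -/
def angleDensityDeriv (f : S3 → ℝ) (h r : S2) (θ : ℝ) : ℝ :=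
  deriv (fun x => angleDensity f h r (arccos x)) (cos θ)

theorem norm_expPoint (ρ : ℝ) (h : S2) : ‖(cos ρ : ℍ[ℝ]) + sin ρ • pureQuat h‖ = 1 := by
  have h1 : ‖(cos ρ : ℍ[ℝ]) + sin ρ • pureQuat h‖ ^ 2 = 1 := by
    have h2 : ‖pureQuat h‖ ^ 2 = 1 := by
      rw [norm_pureQuat, norm_eq_of_mem_sphere h, one_pow]
    rw [sq, ← Quaternion.normSq_eq_norm_mul_self, Quaternion.normSq_def'] at h2 ⊢
    simp only [Quaternion.re_add, Quaternion.imI_add, Quaternion.imJ_add, Quaternion.imK_add,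
      Quaternion.re_smul, Quaternion.imI_smul, Quaternion.imJ_smul, Quaternion.imK_smul,
      Quaternion.re_coe, Quaternion.imI_coe, Quaternion.imJ_coe, Quaternion.imK_coe,
      pureQuat_re, pureQuat_imI, pureQuat_imJ, pureQuat_imK, smul_eq_mul] at h2 ⊢
    linear_combination sin ρ ^ 2 * h2 + sin_sq_add_cos_sq ρ
  nlinarith [norm_nonneg ((cos ρ : ℍ[ℝ]) + sin ρ • pureQuat h)]

/-- The unit quaternion `cos ρ + h sin ρ`. -/
def expPoint (ρ : ℝ) (h : S2) : S3 :=
  ⟨(cos ρ : ℍ[ℝ]) + sin ρ • pureQuat h, mem_sphere_zero_iff_norm.2 (norm_expPoint ρ h)⟩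

/-- The mean value of `f` over the small sphere `{q (cos ρ + h sin ρ) | h ∈ S²}` with centre `q`
and geodesic radius `ρ`. -/
def sphereMean (f : S3 → ℝ) (q : S3) (ρ : ℝ) : ℝ :=
  (4 * π)⁻¹ * ∫ h : S2, f (q * expPoint ρ h) ∂omega2

/-- The dual generalized Radon transform at `q` of a function `φ` of great circles: its mean value
over the rotations `q k q* C k*`, `k ∈ S³`, of a great circle `C` about `q`, that is, over all
great circles whose distance from `q` is that of `C`. -/
def dualRadon (φ : Set S3 → ℝ) (q : S3) (C : Set S3) : ℝ :=
  ∫ k : S3, φ ((fun p => q * k * q⁻¹ * p * k⁻¹) '' C) ∂haarS3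

end

/-!
All objects are expressed through the group `S³`. A point `h` of the two-sphere is written as
`k i k*`; this identifies surface measure with the image of Haar measure (`omega2_eq_map_haarS3`),
and since the sphere of radius `ψ` about `1` is a conjugacy class, the spherical mean of `f` about
`q` is the average of `f (q k p k*)` over `k`, with `p` any unit quaternion of real part `cos ψ`
(`integral_haarS3_conj`). Write `M u` for the spherical mean of radius `arccos u`; it is even in
`u` because `f` is even.

A great circle at distance `arccos v` from `q` has the points `p` with `⟪q, p⟫ = v cos t`, so
averaging over the rotations about `q` first turns the dual Radon transform of `ℛf` into the mean
`G v` of `M (v cos t)` over `t` (`dualRadon_radon`), and `u = v sin t` makes this the Abel integral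
(`circleSphereMean_eq_abel`).

For the inversion formula, the fibre `C_{h,r}` is an orbit of the stabilizer of `i`, and
`(𝒜f)(h, qhq*; θ)` is the mean of `f` over a torus (`angleDensity_rotate`) whose points
satisfy `⟪q, p⟫ = cos (θ / 2) cos t`. Its mean over `h` is therefore
`G (cos (θ / 2))`, and differentiation in `cos θ = 2 cos² (θ / 2) - 1` reduces the claim to
`M 1 = M 0 + ∫ G'(cos φ) dφ` over `0 ≤ φ ≤ π / 2`. The right-hand integral is the double integral
of `(2 / π) sin t M'(cos φ sin t)`, an integral over an octant of the two-sphere of a function of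
one coordinate. By Archimedes' theorem that coordinate is uniformly distributed
(`map_octantMeasure`), so the double integral is `∫ M'` over `[0, 1]`. This argument covers the
integrability as well: `M'` has only an inverse square root singularity at `1`.
-/

noncomputable section

/-! ### Rotations of the two-sphere -/

theorem coe_inv_S3 (q : S3) : ((q⁻¹ : S3) : ℍ[ℝ]) = star (q : ℍ[ℝ]) := by
  have h1 : ((q⁻¹ : S3) : ℍ[ℝ]) * q = 1 := by
    rw [← Metric.unitSphere.coe_mul, inv_mul_cancel, Metric.unitSphere.coe_one]
  have h2 : (q : ℍ[ℝ]) * star (q : ℍ[ℝ]) = 1 := by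
    rw [Quaternion.self_mul_star, Quaternion.normSq_eq_norm_mul_self, norm_eq_of_mem_sphere q]
    simp
  calc ((q⁻¹ : S3) : ℍ[ℝ]) = ((q⁻¹ : S3) : ℍ[ℝ]) * (q * star (q : ℍ[ℝ])) := by rw [h2, mul_one]
    _ = star (q : ℍ[ℝ]) := by rw [← mul_assoc, h1, one_mul]

theorem rotate_mul (a b : S3) (h : S2) : rotate (a * b) h = rotate a (rotate b h) := by
  refine Subtype.ext (pureQuat_injective ?_)
  rw [pureQuat_rotate, pureQuat_rotate, pureQuat_rotate, Metric.unitSphere.coe_mul, star_mul]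
  simp only [mul_assoc]

theorem rotate_one (h : S2) : rotate 1 h = h := by
  refine Subtype.ext (pureQuat_injective ?_)
  rw [pureQuat_rotate]
  simp

theorem rotate_inv_rotate (a : S3) (h : S2) : rotate a⁻¹ (rotate a h) = h := by
  rw [← rotate_mul, inv_mul_cancel, rotate_one]

theorem pureQuat_add (x y : EuclideanSpace ℝ (Fin 3)) :
    pureQuat (x + y) = pureQuat x + pureQuat y := by
  ext <;> simp

theorem pureQuat_smul (c : ℝ) (x : EuclideanSpace ℝ (Fin 3)) :
    pureQuat (c • x) = c • pureQuat x := by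
  ext <;> simp

/-- The rotation `x ↦ k x k*` as a linear isometry of three-space. -/
def rotateLinear (k : S3) : EuclideanSpace ℝ (Fin 3) →ₗᵢ[ℝ] EuclideanSpace ℝ (Fin 3) where
  toFun x := vecPart ((k : ℍ[ℝ]) * pureQuat x * star (k : ℍ[ℝ]))
  map_add' x y := pureQuat_injective <| by
    rw [pureQuat_add, pureQuat_add, pureQuat_vecPart (conj_re _ _), pureQuat_vecPart (conj_re _ _),
      ← add_mul, ← mul_add, ← pureQuat_add, pureQuat_vecPart (conj_re _ _)]
  map_smul' c x := pureQuat_injective <| by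
    rw [RingHom.id_apply, pureQuat_smul, pureQuat_smul, pureQuat_vecPart (conj_re _ _),
      mul_smul_comm, smul_mul_assoc, ← smul_mul_assoc, ← mul_smul_comm, ← pureQuat_smul,
      pureQuat_vecPart (conj_re _ _)]
  norm_map' x := by
    change ‖vecPart _‖ = _
    rw [← norm_pureQuat, pureQuat_vecPart (conj_re _ _), norm_mul, norm_mul, norm_star,
      norm_pureQuat, norm_eq_of_mem_sphere k, one_mul, mul_one]

theorem coe_rotate (k : S3) (h : S2) :
    (rotate k h : EuclideanSpace ℝ (Fin 3)) = rotateLinear k h := rfl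

theorem rotate_neg (k : S3) (h : S2) : rotate k (-h) = -rotate k h := by
  ext1
  rw [coe_rotate]
  simp [coe_rotate]

theorem exists_rotate_eq (h r : S2) : ∃ k, rotate k h = r := fibre_nonempty h r

theorem continuous_vecPart : Continuous vecPart := by
  unfold vecPart
  have h1 := Quaternion.continuous_imI
  have h2 := Quaternion.continuous_imJ
  have h3 := Quaternion.continuous_imK
  fun_prop

theorem continuous_pureQuat : Continuous pureQuat := by
  let L : EuclideanSpace ℝ (Fin 3) →ₗ[ℝ] ℍ[ℝ] :=
    { toFun := pureQuat, map_add' := pureQuat_add, map_smul' := pureQuat_smul }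
  exact L.continuous_of_finiteDimensional

theorem continuous_rotate : Continuous fun p : S3 × S2 => rotate p.1 p.2 := by
  refine Continuous.subtype_mk (continuous_vecPart.comp ?_) _
  have := continuous_pureQuat
  fun_prop

theorem continuous_expPoint (m : S2) : Continuous fun t => expPoint t m := by
  refine Continuous.subtype_mk ?_ _
  have := Quaternion.continuous_coe
  fun_prop

theorem expPoint_zero (m : S2) : expPoint 0 m = 1 := by
  ext1; simp [expPoint]

theorem expPoint_re (t : ℝ) (m : S2) : (expPoint t m : ℍ[ℝ]).re = cos t := by
  simp [expPoint]

theorem conj_expPoint (k : S3) (t : ℝ) (m : S2) :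
    k * expPoint t m * k⁻¹ = expPoint t (rotate k m) := by
  have h2 : (k : ℍ[ℝ]) * star (k : ℍ[ℝ]) = 1 := by
    rw [← coe_inv_S3, ← Metric.unitSphere.coe_mul, mul_inv_cancel, Metric.unitSphere.coe_one]
  ext1
  rw [Metric.unitSphere.coe_mul, Metric.unitSphere.coe_mul, coe_inv_S3]
  simp only [expPoint, pureQuat_rotate, mul_add, add_mul, mul_smul_comm, smul_mul_assoc]
  rw [← Quaternion.coe_commutes, mul_assoc, h2, mul_one]

/-- Every unit quaternion is `cos ψ + m sin ψ` with `ψ` the angle to `1`. -/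
theorem exists_eq_expPoint (p : S3) : ∃ m : S2, p = expPoint (arccos (p : ℍ[ℝ]).re) m := by
  have hp : (p : ℍ[ℝ]).re ^ 2 + (p : ℍ[ℝ]).imI ^ 2 + (p : ℍ[ℝ]).imJ ^ 2 +
      (p : ℍ[ℝ]).imK ^ 2 = 1 := by
    rw [← Quaternion.normSq_def', Quaternion.normSq_eq_norm_mul_self, norm_eq_of_mem_sphere p,
      mul_one]
  have h1 : -1 ≤ (p : ℍ[ℝ]).re := by
    nlinarith [sq_nonneg (p : ℍ[ℝ]).imI, sq_nonneg (p : ℍ[ℝ]).imJ, sq_nonneg (p : ℍ[ℝ]).imK]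
  have h2 : (p : ℍ[ℝ]).re ≤ 1 := by
    nlinarith [sq_nonneg (p : ℍ[ℝ]).imI, sq_nonneg (p : ℍ[ℝ]).imJ, sq_nonneg (p : ℍ[ℝ]).imK]
  have hv : ‖vecPart (p : ℍ[ℝ])‖ ^ 2 = 1 - (p : ℍ[ℝ]).re ^ 2 := by
    rw [EuclideanSpace.norm_sq_eq]
    simp [vecPart, Fin.sum_univ_three]
    linarith
  have hs : sin (arccos (p : ℍ[ℝ]).re) = ‖vecPart (p : ℍ[ℝ])‖ := by
    rw [sin_arccos, ← hv, sqrt_sq (norm_nonneg _)]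
  have hsplit : (p : ℍ[ℝ]) = ((p : ℍ[ℝ]).re : ℍ[ℝ]) + pureQuat (vecPart (p : ℍ[ℝ])) := by
    ext <;> simp [vecPart]
  by_cases h0 : vecPart (p : ℍ[ℝ]) = 0
  · refine ⟨⟨EuclideanSpace.single 0 1, by simp⟩, ?_⟩
    ext1
    simp only [expPoint]
    rw [hs, h0, norm_zero, zero_smul, cos_arccos h1 h2, add_zero]
    rw [h0] at hsplit
    rw [hsplit]
    ext <;> simp
  · refine ⟨⟨‖vecPart (p : ℍ[ℝ])‖⁻¹ • vecPart (p : ℍ[ℝ]), ?_⟩, ?_⟩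
    · rw [mem_sphere_zero_iff_norm, norm_smul, norm_inv, norm_norm,
        inv_mul_cancel₀ (norm_ne_zero_iff.2 h0)]
    · ext1
      simp only [expPoint]
      rw [hs, pureQuat_smul, smul_smul, mul_inv_cancel₀ (norm_ne_zero_iff.2 h0), one_smul,
        cos_arccos h1 h2, ← hsplit]

/-! ### Great circles and small circles as orbits -/

/-- The vector corresponding to the quaternion `i`. -/
def axisI : S2 := ⟨EuclideanSpace.single 0 1, by simp⟩

/-- The vector corresponding to the quaternion `k`. -/
def axisK : S2 := ⟨EuclideanSpace.single 2 1, by simp⟩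

/-- The uniform probability measure on an interval of length `2π`, that is, on the angles of a
circle. -/
def angleMeasure : Measure ℝ := ENNReal.ofReal (2 * π)⁻¹ • volume.restrict (Ioc 0 (2 * π))

instance : IsProbabilityMeasure angleMeasure where
  measure_univ := by
    simp only [angleMeasure, Measure.smul_apply, Measure.restrict_apply_univ, Real.volume_Ioc,
      smul_eq_mul, sub_zero]
    rw [← ENNReal.ofReal_mul (by positivity), inv_mul_cancel₀ (by positivity), ENNReal.ofReal_one]

theorem integral_angleMeasure (F : ℝ → ℝ) :
    ∫ t, F t ∂angleMeasure = (2 * π)⁻¹ * ∫ t in (0 : ℝ)..2 * π, F t := by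
  rw [angleMeasure, integral_smul_measure, ENNReal.toReal_ofReal (by positivity),
    intervalIntegral.integral_of_le (by positivity), smul_eq_mul]

theorem CircleFrame.mean_eq_integral {E : Type*} [NormedAddCommGroup E] [InnerProductSpace ℝ E]
    (γ : CircleFrame E) (F : sphere (0 : E) 1 → ℝ) :
    γ.mean F = ∫ t, F (γ.pt t) ∂angleMeasure := by
  rw [integral_angleMeasure, CircleFrame.mean]

theorem radon_greatCircle_eq_integral (f : S3 → ℝ) (q₁ q₂ : S3)
    (h : ⟪(q₁ : ℍ[ℝ]), (q₂ : ℍ[ℝ])⟫ = 0) :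
    radon f (greatCircle q₁ q₂) = ∫ t, f ((greatFrame q₁ q₂ h).pt t) ∂angleMeasure := by
  rw [integral_angleMeasure, radon_greatCircle]

/-- The unit quaternions fixing `i` are the `cos t + i sin t`. -/
theorem rotate_axisI_eq_axisI_iff (y : S3) :
    rotate y axisI = axisI ↔ ∃ t, y = expPoint t axisI := by
  rw [show rotate y axisI = axisI ↔ y ∈ fibre axisI axisI from Iff.rfl, mem_fibre]
  constructor
  · intro h
    have e2 := congrArg (fun z => z.imJ) h
    have e3 := congrArg (fun z => z.imK) h
    simp [axisI] at e2 e3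
    have hJ : (y : ℍ[ℝ]).imJ = 0 := by linarith
    have hK : (y : ℍ[ℝ]).imK = 0 := by linarith
    have hy : (y : ℍ[ℝ]).re ^ 2 + (y : ℍ[ℝ]).imI ^ 2 = 1 := by
      have := Quaternion.normSq_def' (a := (y : ℍ[ℝ]))
      rw [Quaternion.normSq_eq_norm_mul_self, norm_eq_of_mem_sphere y, hJ, hK] at this
      linarith
    obtain ⟨t, h1, h2⟩ := exists_cos_sin hy
    refine ⟨t, ?_⟩
    ext1
    ext <;> simp [expPoint, axisI, h1, h2, hJ, hK]
  · rintro ⟨t, rfl⟩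
    simp only [expPoint, add_mul, mul_add, smul_mul_assoc, mul_smul_comm]
    rw [Quaternion.coe_commutes]

theorem inner_mul_mul (a x y b : ℍ[ℝ]) (ha : ‖a‖ = 1) (hb : ‖b‖ = 1) :
    ⟪a * x * b, a * y * b⟫ = ⟪x, y⟫ := by
  have h : ∀ z : ℍ[ℝ], ‖a * z * b‖ = ‖z‖ := fun z => by simp [ha, hb]
  rw [real_inner_eq_norm_add_mul_self_sub_norm_mul_self_sub_norm_mul_self_div_two,
    real_inner_eq_norm_add_mul_self_sub_norm_mul_self_sub_norm_mul_self_div_two,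
    ← add_mul, ← mul_add, h, h, h]

/-- The fibre over two rotated copies of `i` is an orbit of the stabilizer of `i`, so the Radon
transform is an average over this orbit. -/
theorem radon_fibre_rotate (f : S3 → ℝ) (k x : S3) :
    radon f (fibre (rotate k axisI) (rotate x axisI)) =
      ∫ t, f (x * expPoint t axisI * k⁻¹) ∂angleMeasure := by
  let j : S3 := expPoint (π / 2) axisI
  have hj : (j : ℍ[ℝ]) = pureQuat axisI := by simp [j, expPoint]
  have hpt : ∀ t, ((x * expPoint t axisI * k⁻¹ : S3) : ℍ[ℝ]) =
      cos t • ((x * 1 * k⁻¹ : S3) : ℍ[ℝ]) + sin t • ((x * j * k⁻¹ : S3) : ℍ[ℝ]) := by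
    intro t
    simp only [Metric.unitSphere.coe_mul, hj, Metric.unitSphere.coe_one]
    simp only [expPoint, mul_add, add_mul, mul_smul_comm, smul_mul_assoc, mul_one]
    rw [← Quaternion.coe_commutes, mul_assoc (cos t : ℍ[ℝ]), Quaternion.coe_mul_eq_smul]
  have hfib : fibre (rotate k axisI) (rotate x axisI) =
      greatCircle (x * 1 * k⁻¹) (x * j * k⁻¹) := by
    ext p
    have h1 : p ∈ fibre (rotate k axisI) (rotate x axisI) ↔
        rotate (x⁻¹ * p * k) axisI = axisI := by
      rw [rotate_mul, rotate_mul]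
      constructor
      · intro h
        rw [show rotate p (rotate k axisI) = _ from h, rotate_inv_rotate]
      · intro h
        have := congrArg (rotate x) h
        rwa [← rotate_mul x, mul_inv_cancel, rotate_one] at this
    rw [h1, rotate_axisI_eq_axisI_iff]
    refine exists_congr fun t => ?_
    rw [← hpt, Subtype.coe_inj]
    constructor
    · intro h
      rw [← h]; group
    · rintro rfl
      group
  have horth : ⟪((x * 1 * k⁻¹ : S3) : ℍ[ℝ]), ((x * j * k⁻¹ : S3) : ℍ[ℝ])⟫ = 0 := by
    simp only [Metric.unitSphere.coe_mul]
    rw [inner_mul_mul _ _ _ _ (norm_eq_of_mem_sphere x) (norm_eq_of_mem_sphere k⁻¹), hj,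
      Quaternion.inner_def]
    simp
  rw [hfib, radon_greatCircle_eq_integral f _ _ horth]
  refine integral_congr_ae (ae_of_all _ fun t => congrArg f ?_)
  ext1
  rw [hpt]
  simp [CircleFrame.pt, greatFrame]

/-- The rotation carrying `i` to the point `i cos θ + sin θ (j cos t + k sin t)`. -/
theorem rotate_expPoint_mul_expPoint (t θ : ℝ) :
    (rotate (expPoint (t / 2) axisI * expPoint (θ / 2) axisK) axisI : EuclideanSpace ℝ (Fin 3)) =
      !₂[cos θ, sin θ * cos t, sin θ * sin t] := by
  obtain ⟨a, rfl⟩ : ∃ a, t = 2 * a := ⟨t / 2, by ring⟩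
  obtain ⟨b, rfl⟩ : ∃ b, θ = 2 * b := ⟨θ / 2, by ring⟩
  have ha := sin_sq_add_cos_sq a
  have hb := sin_sq_add_cos_sq b
  rw [rotate_mul, show 2 * a / 2 = a by ring, show 2 * b / 2 = b by ring]
  have h1 : pureQuat (rotate (expPoint b axisK) axisI) =
      pureQuat !₂[cos (2 * b), sin (2 * b), 0] := by
    rw [pureQuat_rotate, cos_two_mul, sin_two_mul]
    ext <;> simp [expPoint, axisI, axisK]
    · linear_combination (-1) * hb
    · ring
  refine pureQuat_injective ?_
  rw [pureQuat_rotate, h1, cos_two_mul a, sin_two_mul a]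
  ext <;> simp [expPoint, axisI]
  · ring
  · linear_combination cos (2 * b) * ha
  · linear_combination (-sin (2 * b)) * ha
  · ring

/-- The orthogonal frame of the small circle about `x i x*`, obtained from the standard one. -/
def rotatedFrame (x : S3) (θ : ℝ) : CircleFrame (EuclideanSpace ℝ (Fin 3)) where
  c := rotateLinear x !₂[cos θ, 0, 0]
  a := rotateLinear x !₂[0, sin θ, 0]
  b := rotateLinear x !₂[0, 0, sin θ]
  inner_ab := by
    rw [LinearIsometry.inner_map_map]; simp [PiLp.inner_apply, Fin.sum_univ_three]
  inner_ca := by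
    rw [LinearIsometry.inner_map_map]; simp [PiLp.inner_apply, Fin.sum_univ_three]
  inner_cb := by
    rw [LinearIsometry.inner_map_map]; simp [PiLp.inner_apply, Fin.sum_univ_three]
  norm_a := by
    rw [LinearIsometry.norm_map, LinearIsometry.norm_map, EuclideanSpace.norm_sq_eq,
      EuclideanSpace.norm_sq_eq]
    simp [Fin.sum_univ_three]
  norm_b := by
    rw [LinearIsometry.norm_map, LinearIsometry.norm_map, EuclideanSpace.norm_sq_eq,
      EuclideanSpace.norm_sq_eq]
    simp [Fin.sum_univ_three]

theorem rotatedFrame_pt (x : S3) (θ t : ℝ) : (rotatedFrame x θ).pt t =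
    rotate (x * expPoint (t / 2) axisI * expPoint (θ / 2) axisK) axisI := by
  ext1
  rw [mul_assoc, rotate_mul, coe_rotate, rotate_expPoint_mul_expPoint]
  simp only [CircleFrame.pt, rotatedFrame, ← map_smul, ← map_add]
  congr 1
  ext i
  fin_cases i <;> simp [mul_comm]

theorem range_rotatedFrame_pt (x : S3) (θ : ℝ) :
    range (rotatedFrame x θ).pt = smallCircle (rotate x axisI) θ := by
  have hin : ∀ r' : S2, ⟪(rotate x axisI : EuclideanSpace ℝ (Fin 3)),
      (r' : EuclideanSpace ℝ (Fin 3))⟫ = (rotate x⁻¹ r' : EuclideanSpace ℝ (Fin 3)) 0 := by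
    intro r'
    have h1 : r' = rotate x (rotate x⁻¹ r') := by rw [← rotate_mul, mul_inv_cancel, rotate_one]
    conv_lhs => rw [h1]
    rw [coe_rotate x, coe_rotate x, LinearIsometry.inner_map_map]
    simp [axisI, PiLp.inner_apply]
  ext r'
  rw [smallCircle, mem_ofPred_eq, hin]
  constructor
  · rintro ⟨t, rfl⟩
    rw [rotatedFrame_pt, mul_assoc, rotate_mul, rotate_inv_rotate, rotate_expPoint_mul_expPoint]
    simp
  · intro h
    set w := rotate x⁻¹ r' with hw
    have hr : r' = rotate x w := by rw [hw, ← rotate_mul, mul_inv_cancel, rotate_one]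
    have hn : ‖(w : EuclideanSpace ℝ (Fin 3))‖ ^ 2 = 1 := by
      rw [norm_eq_of_mem_sphere w, one_pow]
    rw [EuclideanSpace.norm_sq_eq, Fin.sum_univ_three] at hn
    simp only [Real.norm_eq_abs, sq_abs, h] at hn
    have hsum : (w : EuclideanSpace ℝ (Fin 3)) 1 ^ 2 + (w : EuclideanSpace ℝ (Fin 3)) 2 ^ 2 =
        sin θ ^ 2 := by linarith [sin_sq_add_cos_sq θ]
    have ht : ∃ t : ℝ, sin θ * cos t = (w : EuclideanSpace ℝ (Fin 3)) 1 ∧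
        sin θ * sin t = (w : EuclideanSpace ℝ (Fin 3)) 2 := by
      generalize (w : EuclideanSpace ℝ (Fin 3)) 1 = X at hsum ⊢
      generalize (w : EuclideanSpace ℝ (Fin 3)) 2 = Y at hsum ⊢
      by_cases hs : sin θ = 0
      · rw [hs] at hsum ⊢
        exact ⟨0, by nlinarith [sq_nonneg X, sq_nonneg Y], by nlinarith [sq_nonneg X, sq_nonneg Y]⟩
      · obtain ⟨t, h1, h2⟩ := exists_cos_sin (x := X / sin θ) (y := Y / sin θ)
          (by rw [div_pow, div_pow, ← add_div, hsum, div_self (pow_ne_zero 2 hs)])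
        exact ⟨t, by rw [h1]; field_simp, by rw [h2]; field_simp⟩
    obtain ⟨t, h1, h2⟩ := ht
    refine ⟨t, ?_⟩
    rw [rotatedFrame_pt, hr, mul_assoc, rotate_mul]
    congr 1
    ext1
    rw [rotate_expPoint_mul_expPoint]
    ext i
    fin_cases i <;> simp [h, h1, h2]

/-- The angle density function as a mean value of `f` over a torus. -/
theorem angleDensity_rotate (f : S3 → ℝ) (k x : S3) (θ : ℝ) :
    angleDensity f (rotate k axisI) (rotate x axisI) θ =
      ∫ t, ∫ s, f (x * expPoint (t / 2) axisI * expPoint (θ / 2) axisK *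
        (expPoint s axisI * k⁻¹)) ∂angleMeasure ∂angleMeasure := by
  rw [angleDensity, ← range_rotatedFrame_pt, circleMean_range, CircleFrame.mean_eq_integral]
  simp only [rotatedFrame_pt, radon_fibre_rotate, mul_assoc]

/-- The Radon transform at the antipode of `q h q*` is the torus mean in the degenerate case in
which the small circle shrinks to a point. -/
theorem radon_fibre_neg_rotate (f : S3 → ℝ) (q k : S3) :
    radon f (fibre (rotate k axisI) (-rotate q (rotate k axisI))) =
      ∫ s, f (q * k * expPoint (π / 2) axisK * (expPoint s axisI * k⁻¹)) ∂angleMeasure := by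
  have h1 : rotate (expPoint (π / 2) axisK) axisI = -axisI := by
    refine Subtype.ext (pureQuat_injective ?_)
    rw [pureQuat_rotate]
    ext <;> simp [expPoint, axisI, axisK]
  rw [← rotate_neg, ← rotate_neg, ← h1, ← rotate_mul, ← rotate_mul, radon_fibre_rotate]
  simp only [mul_assoc]

/-! ### Haar measure and surface measure -/

instance isHaarMeasure_haarS3 : haarS3.IsHaarMeasure :=
  Measure.isHaarMeasure_haarMeasure ⊤

instance isProbabilityMeasure_haarS3 : IsProbabilityMeasure haarS3 where
  measure_univ := Measure.haarMeasure_self (K₀ := (⊤ : TopologicalSpace.PositiveCompacts S3))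

/-- Right translates of Haar measure on a compact group are invariant probability measures,
hence equal to it. -/
instance isMulRightInvariant_haarS3 : haarS3.IsMulRightInvariant where
  map_mul_right_eq_self g := by
    have : IsProbabilityMeasure (haarS3.map (· * g)) :=
      Measure.isProbabilityMeasure_map (measurable_mul_const g).aemeasurable
    exact Measure.isHaarMeasure_eq_of_isProbabilityMeasure _ _

instance isFiniteMeasure_omega2 : IsFiniteMeasure omega2 := by
  unfold omega2; infer_instance

theorem omega2_univ : omega2 univ = ENNReal.ofReal (4 * π) := by
  rw [omega2, Measure.toSphere_apply_univ, EuclideanSpace.volume_ball_fin_three]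
  simp only [finrank_euclideanSpace, Fintype.card_fin, ENNReal.ofReal_one, one_pow, one_mul]
  rw [← ENNReal.ofReal_natCast, ← ENNReal.ofReal_mul (by positivity)]
  congr 1
  push_cast
  ring

theorem measurable_rotate (k : S3) : Measurable (rotate k) :=
  (continuous_rotate.comp (f := fun h => (k, h)) (by fun_prop)).measurable

open Pointwise in
/-- Surface measure is invariant under rotations, as Lebesgue measure is. -/
theorem omega2_preimage_rotate (k : S3) {A : Set S2} (hA : MeasurableSet A) :
    omega2 (rotate k ⁻¹' A) = omega2 A := by
  let R : EuclideanSpace ℝ (Fin 3) ≃ₗᵢ[ℝ] EuclideanSpace ℝ (Fin 3) :=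
    (rotateLinear k).toLinearIsometryEquiv rfl
  have hR : ∀ h : S2, R h = rotate k h := fun h => rfl
  have hset : Ioo (0 : ℝ) 1 • (Subtype.val '' (rotate k ⁻¹' A)) =
      R ⁻¹' (Ioo (0 : ℝ) 1 • (Subtype.val '' A)) := by
    ext x
    simp only [mem_smul, mem_preimage, mem_image]
    constructor
    · rintro ⟨c, hc, _, ⟨h, hh, rfl⟩, rfl⟩
      exact ⟨c, hc, _, ⟨rotate k h, hh, rfl⟩, by rw [map_smul, hR]⟩
    · rintro ⟨c, hc, _, ⟨h, hh, rfl⟩, hx⟩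
      obtain ⟨h', rfl⟩ : ∃ h', rotate k h' = h :=
        ⟨rotate k⁻¹ h, by rw [← rotate_mul, mul_inv_cancel, rotate_one]⟩
      refine ⟨c, hc, _, ⟨h', hh, rfl⟩, R.injective ?_⟩
      rw [map_smul, hR, hx]
  rw [omega2, Measure.toSphere_apply' _ hA, Measure.toSphere_apply' _ (measurable_rotate k hA),
    hset, R.measurePreserving.measure_preimage_emb R.toHomeomorph.measurableEmbedding]

theorem continuous_rotate_left (h : S2) : Continuous fun k => rotate k h :=
  continuous_rotate.comp (f := fun k => (k, h)) (by fun_prop)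

theorem haarS3_setOf_rotate_mem (h r : S2) (A : Set S2) :
    haarS3 ((fun k => rotate k h) ⁻¹' A) = haarS3 ((fun k => rotate k r) ⁻¹' A) := by
  obtain ⟨m, rfl⟩ := exists_rotate_eq h r
  have : (fun k => rotate k (rotate m h)) ⁻¹' A =
      (fun k => k * m) ⁻¹' ((fun k => rotate k h) ⁻¹' A) := by
    ext k; simp [rotate_mul]
  rw [this, measure_preimage_mul_right]

/-- The orbit map of a point carries Haar measure to normalized surface measure: averaging an
invariant measure over the group, both in the point and in the group element, shows that an
invariant measure of given mass on a homogeneous space of a compact group is unique. -/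
theorem omega2_eq_map_haarS3 (h : S2) :
    omega2 = ENNReal.ofReal (4 * π) • haarS3.map (fun k => rotate k h) := by
  ext A hA
  have hAm : Measurable (A.indicator fun _ => (1 : ENNReal)) := measurable_const.indicator hA
  have h1 : ∀ k : S3, ∫⁻ r, A.indicator (fun _ => (1 : ENNReal)) (rotate k r) ∂omega2 =
      omega2 A := by
    intro k
    rw [← omega2_preimage_rotate k hA, ← lintegral_indicator_one (measurable_rotate k hA)]
    rfl
  have h2 : ∀ r : S2, ∫⁻ k, A.indicator (fun _ => (1 : ENNReal)) (rotate k r) ∂haarS3 =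
      haarS3 ((fun k => rotate k h) ⁻¹' A) := by
    intro r
    rw [haarS3_setOf_rotate_mem h r A,
      ← lintegral_indicator_one ((continuous_rotate_left r).measurable hA)]
    rfl
  have h3 := lintegral_lintegral_swap (μ := haarS3) (ν := omega2)
    (f := fun k r => A.indicator (fun _ => (1 : ENNReal)) (rotate k r))
    (hAm.comp continuous_rotate.measurable).aemeasurable
  simp only [h1, h2, lintegral_const, measure_univ, mul_one, omega2_univ] at h3
  rw [h3, Measure.smul_apply, Measure.map_apply (continuous_rotate_left h).measurable hA,
    smul_eq_mul, mul_comm]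

theorem integral_omega2 (h : S2) {F : S2 → ℝ} (hF : Continuous F) :
    ∫ r, F r ∂omega2 = 4 * π * ∫ k, F (rotate k h) ∂haarS3 := by
  rw [omega2_eq_map_haarS3 h, integral_smul_measure, ENNReal.toReal_ofReal (by positivity),
    integral_map (continuous_rotate_left h).aemeasurable hF.aestronglyMeasurable, smul_eq_mul]

/-- The two-sphere has the quotient topology of the group. -/
theorem continuous_of_comp_rotate (h : S2) {F : S2 → ℝ}
    (hF : Continuous fun k => F (rotate k h)) : Continuous F :=
  ((continuous_rotate_left h).isClosedMap.isQuotientMap (continuous_rotate_left h)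
    (exists_rotate_eq h)).continuous_iff.2 hF

theorem integrable_omega2 {F : S2 → ℝ} (hF : Continuous F) : Integrable F omega2 :=
  hF.integrable_of_hasCompactSupport (HasCompactSupport.of_compactSpace F)

/-- The mean value of `f` over the conjugacy class of `p`, translated by `q`, is a spherical mean
about `q`: conjugacy classes of unit quaternions are the spheres about `1`. -/
theorem integral_haarS3_conj {f : S3 → ℝ} (hf : Continuous f) (q p : S3) :
    ∫ k, f (q * (k * p * k⁻¹)) ∂haarS3 = sphereMean f q (arccos (p : ℍ[ℝ]).re) := by
  obtain ⟨m, hm⟩ := exists_eq_expPoint p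
  set ψ := arccos (p : ℍ[ℝ]).re
  have hc : Continuous fun h => expPoint ψ h := by
    refine Continuous.subtype_mk ?_ _
    have := continuous_pureQuat
    fun_prop
  have hF : Continuous fun h => f (q * expPoint ψ h) := hf.comp (continuous_const.mul hc)
  rw [sphereMean, integral_omega2 m hF, hm]
  simp only [conj_expPoint]
  rw [← mul_assoc, inv_mul_cancel₀ (by positivity), one_mul]

/-! ### Differentiation along one-parameter subgroups -/

/-- The complement of the origin, as an open submanifold. -/
def puncturedQuaternions : TopologicalSpace.Opens ℍ[ℝ] := ⟨{0}ᶜ, isOpen_compl_singleton⟩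

/-- The radial projection onto the unit quaternions. -/
def radialProj (x : puncturedQuaternions) : S3 :=
  codRestrict (fun x : puncturedQuaternions => ‖(x : ℍ[ℝ])‖⁻¹ • (x : ℍ[ℝ])) (sphere 0 1)
    (fun x => by
      have hx : (x : ℍ[ℝ]) ≠ 0 := x.2
      rw [mem_sphere_zero_iff_norm, norm_smul, norm_inv, norm_norm,
        inv_mul_cancel₀ (norm_ne_zero_iff.2 hx)]) x

theorem contMDiff_radialProj : ContMDiff 𝓘(ℝ, ℍ[ℝ]) (𝓡 3) 1 radialProj := by
  refine ContMDiff.codRestrict_sphere ?_ _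
  intro x
  have hx : (x : ℍ[ℝ]) ≠ 0 := x.2
  have h : ContDiffAt ℝ 1 (fun y : ℍ[ℝ] => ‖y‖⁻¹ • y) x :=
    ((contDiffAt_norm ℝ hx).inv (norm_ne_zero_iff.2 hx)).smul contDiffAt_id
  exact contMDiffAt_subtype_iff.2 h.contMDiffAt

/-- The extension of a function on the unit quaternions to all nonzero quaternions, constant along
rays; its value at the origin is irrelevant. -/
def radialExtension (f : S3 → ℝ) (x : ℍ[ℝ]) : ℝ :=
  open Classical in if hx : x ≠ 0 then f (radialProj ⟨x, hx⟩) else 0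

theorem radialExtension_coe (f : S3 → ℝ) (p : S3) : radialExtension f p = f p := by
  rw [radialExtension, dif_pos (ne_zero_of_mem_unit_sphere p)]
  congr 1
  ext1
  simp [radialProj]

theorem contDiffOn_radialExtension {f : S3 → ℝ} (hf : ContMDiff (𝓡 3) 𝓘(ℝ, ℝ) 1 f) :
    ContDiffOn ℝ 1 (radialExtension f) {0}ᶜ := by
  intro x hx
  have h1 : ContMDiffAt 𝓘(ℝ, ℍ[ℝ]) 𝓘(ℝ, ℝ) 1
      (fun y : puncturedQuaternions => radialExtension f y) ⟨x, hx⟩ := by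
    have h2 : (fun y : puncturedQuaternions => radialExtension f y) = f ∘ radialProj := by
      ext y
      rw [radialExtension, dif_pos (show (y : ℍ[ℝ]) ≠ 0 from y.2)]
      rfl
    rw [h2]
    exact (hf.comp contMDiff_radialProj) _
  exact (contMDiffAt_subtype_iff.1 h1).contDiffAt.contDiffWithinAt

theorem hasDerivAt_coe_expPoint (m : S2) (ψ : ℝ) :
    HasDerivAt (fun t => (expPoint t m : ℍ[ℝ])) ((expPoint ψ m : ℍ[ℝ]) * pureQuat m) ψ := by
  have h1 : ∀ t, (expPoint t m : ℍ[ℝ]) = cos t • (1 : ℍ[ℝ]) + sin t • pureQuat m := by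
    intro t
    simp only [expPoint]
    congr 1
    ext <;> simp
  have h2 : (expPoint ψ m : ℍ[ℝ]) * pureQuat m = (-sin ψ) • (1 : ℍ[ℝ]) + cos ψ • pureQuat m := by
    rw [h1, add_mul, smul_mul_assoc, smul_mul_assoc, pureQuat_mul_self, one_mul, smul_neg, neg_smul]
    abel
  rw [h2, funext h1]
  exact ((hasDerivAt_cos ψ).smul_const (1 : ℍ[ℝ])).add
    ((hasDerivAt_sin ψ).smul_const (pureQuat m))

/-- A continuously differentiable function on the unit quaternions is differentiable along each
curve `ψ ↦ a (cos ψ + m sin ψ) b`, with a derivative that depends continuously on the point of the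
curve and on `b`. -/
theorem exists_continuous_hasDerivAt_expPoint {f : S3 → ℝ}
    (hf : ContMDiff (𝓡 3) 𝓘(ℝ, ℝ) 1 f) (m : S2) :
    ∃ g : S3 × S3 → ℝ, Continuous g ∧ ∀ a b ψ,
      HasDerivAt (fun t => f (a * expPoint t m * b)) (g (a * expPoint ψ m, b)) ψ := by
  have hF := contDiffOn_radialExtension hf
  have hopen : IsOpen ({0}ᶜ : Set ℍ[ℝ]) := isOpen_compl_singleton
  refine ⟨fun p => fderiv ℝ (radialExtension f) ((p.1 : ℍ[ℝ]) * (p.2 : ℍ[ℝ]))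
    ((p.1 : ℍ[ℝ]) * pureQuat m * (p.2 : ℍ[ℝ])), ?_, fun a b ψ => ?_⟩
  · have h1 := hF.continuousOn_fderiv_of_isOpen hopen le_rfl
    have h2 : Continuous fun p : S3 × S3 =>
        fderiv ℝ (radialExtension f) ((p.1 : ℍ[ℝ]) * (p.2 : ℍ[ℝ])) :=
      h1.comp_continuous (by fun_prop) fun p => by
        rw [← Metric.unitSphere.coe_mul]
        exact ne_zero_of_mem_unit_sphere (p.1 * p.2)
    exact h2.clm_apply (by fun_prop)
  · have hne : ((a * expPoint ψ m * b : S3) : ℍ[ℝ]) ≠ 0 := ne_zero_of_mem_unit_sphere _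
    have h1 : HasFDerivAt (radialExtension f) _ ((a * expPoint ψ m * b : S3) : ℍ[ℝ]) :=
      ((hF.contDiffAt (hopen.mem_nhds hne)).differentiableAt one_ne_zero).hasFDerivAt
    have h2 : HasDerivAt (fun t => ((a * expPoint t m * b : S3) : ℍ[ℝ]))
        ((a : ℍ[ℝ]) * ((expPoint ψ m : ℍ[ℝ]) * pureQuat m) * b) ψ :=
      ((hasDerivAt_coe_expPoint m ψ).const_mul (a : ℍ[ℝ])).mul_const (b : ℍ[ℝ])
    have h3 := h1.comp_hasDerivAt ψ h2
    simp only [Function.comp_def, radialExtension_coe] at h3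
    simpa only [Metric.unitSphere.coe_mul, mul_assoc] using h3

theorem exists_abs_le_of_continuous {X : Type*} [TopologicalSpace X] [CompactSpace X]
    {g : X → ℝ} (hg : Continuous g) : ∃ B, ∀ x, |g x| ≤ B := by
  obtain ⟨B, hB⟩ := isCompact_univ.exists_bound_of_continuousOn hg.continuousOn
  exact ⟨B, fun x => hB x (mem_univ x)⟩

theorem integrable_comp_of_continuous {Ω : Type*} [MeasurableSpace Ω] {μ : Measure Ω}
    [IsFiniteMeasure μ] {X : Type*} [TopologicalSpace X] [CompactSpace X] [MeasurableSpace X]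
    [OpensMeasurableSpace X] {g : X → ℝ} (hg : Continuous g) {φ : Ω → X} (hφ : Measurable φ) :
    Integrable (fun ω => g (φ ω)) μ := by
  obtain ⟨B, hB⟩ := exists_abs_le_of_continuous hg
  exact Integrable.of_bound (hg.measurable.comp hφ).aestronglyMeasurable B
    (ae_of_all _ fun ω => hB _)

/-- Differentiation under the integral sign for averages of a continuously differentiable
function. -/
theorem hasDerivAt_integral_expPoint {f : S3 → ℝ} (hfc : Continuous f) {m : S2} {g : S3 × S3 → ℝ}
    (hg : Continuous g)
    (hfg : ∀ a b ψ, HasDerivAt (fun t => f (a * expPoint t m * b)) (g (a * expPoint ψ m, b)) ψ)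
    {Ω : Type*} [MeasurableSpace Ω] (μ : Measure Ω) [IsFiniteMeasure μ] {a b : Ω → S3}
    (ha : Measurable a) (hb : Measurable b) (ψ : ℝ) :
    HasDerivAt (fun t => ∫ ω, f (a ω * expPoint t m * b ω) ∂μ)
      (∫ ω, g (a ω * expPoint ψ m, b ω) ∂μ) ψ := by
  obtain ⟨B, hB⟩ := exists_abs_le_of_continuous hg
  have h1 : ∀ t, Measurable fun ω => a ω * expPoint t m * b ω :=
    fun t => (ha.mul_const _).mul hb
  exact (hasDerivAt_integral_of_dominated_loc_of_deriv_le (bound := fun _ => B) Filter.univ_mem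
    (Filter.Eventually.of_forall fun t => (hfc.measurable.comp (h1 t)).aestronglyMeasurable)
    (integrable_comp_of_continuous hfc (h1 ψ))
    (hg.measurable.comp ((ha.mul_const _).prodMk hb)).aestronglyMeasurable
    (ae_of_all _ fun ω t _ => hB _) (integrable_const B)
    (ae_of_all _ fun ω t _ => hfg _ _ _)).2

theorem continuous_integral_of_continuous {Ω : Type*} [TopologicalSpace Ω] [MeasurableSpace Ω]
    [OpensMeasurableSpace Ω] {μ : Measure Ω}
    [IsFiniteMeasure μ] {X Y : Type*} [TopologicalSpace X] [CompactSpace X] [MeasurableSpace X]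
    [BorelSpace X] [TopologicalSpace Y] [FirstCountableTopology Y]
    {g : X → ℝ} (hg : Continuous g) {φ : Y × Ω → X} (hφ : Continuous φ) :
    Continuous fun y => ∫ ω, g (φ (y, ω)) ∂μ := by
  obtain ⟨B, hB⟩ := exists_abs_le_of_continuous hg
  refine continuous_of_dominated (bound := fun _ => B) (fun y => ?_)
    (fun y => ae_of_all _ fun ω => hB _) (integrable_const B) (ae_of_all _ fun ω => ?_)
  · have h : Continuous fun ω => φ (y, ω) := hφ.comp (by fun_prop)
    exact (hg.measurable.comp h.measurable).aestronglyMeasurable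
  · exact hg.comp (hφ.comp (by fun_prop))

/-! ### Archimedes' theorem on an octant of the sphere -/

/-- Two finite measures on a compact interval with the same moments agree, since polynomials are
dense in the continuous functions. -/
theorem ext_of_forall_integral_pow_eq {a b : ℝ} {μ ν : Measure ℝ} [IsFiniteMeasure μ]
    [IsFiniteMeasure ν] (hμ : ∀ᵐ x ∂μ, x ∈ Icc a b) (hν : ∀ᵐ x ∂ν, x ∈ Icc a b)
    (h : ∀ n : ℕ, ∫ x, x ^ n ∂μ = ∫ x, x ^ n ∂ν) : μ = ν := by
  have hint : ∀ (κ : Measure ℝ) [IsFiniteMeasure κ], (∀ᵐ x ∂κ, x ∈ Icc a b) →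
      ∀ g : ℝ → ℝ, Continuous g → Integrable g κ := by
    intro κ _ hκ g hg
    obtain ⟨B, hB⟩ := (isCompact_Icc (a := a) (b := b)).exists_bound_of_continuousOn hg.continuousOn
    exact Integrable.of_bound hg.aestronglyMeasurable B (hκ.mono fun x hx => hB x hx)
  have hpoly : ∀ p : Polynomial ℝ, ∫ x, p.eval x ∂μ = ∫ x, p.eval x ∂ν := by
    intro p
    induction p using Polynomial.induction_on' with
    | add p r hp hr =>
      simp only [Polynomial.eval_add]
      rw [integral_add (hint μ hμ _ p.continuous) (hint μ hμ _ r.continuous),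
        integral_add (hint ν hν _ p.continuous) (hint ν hν _ r.continuous), hp, hr]
    | monomial n c =>
      simp only [Polynomial.eval_monomial, integral_const_mul, h n]
  refine ext_of_forall_integral_eq_of_IsFiniteMeasure fun g => ?_
  have hbound : ∀ (κ : Measure ℝ) [IsFiniteMeasure κ], (∀ᵐ x ∂κ, x ∈ Icc a b) →
      ∀ (p : Polynomial ℝ) (ε : ℝ), (∀ x ∈ Icc a b, |p.eval x - g x| < ε) →
        |∫ x, p.eval x ∂κ - ∫ x, g x ∂κ| ≤ ε * κ.real univ := by
    intro κ _ hκ p ε hp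
    rw [← integral_sub (hint κ hκ _ p.continuous) (hint κ hκ _ g.continuous)]
    exact norm_integral_le_of_norm_le_const (f := fun x => p.eval x - g x) (C := ε)
      (hκ.mono fun x hx => (hp x hx).le)
  refine eq_of_forall_dist_le fun δ hδ => ?_
  set c := μ.real univ + ν.real univ + 1
  have hc : 0 < c := by positivity
  obtain ⟨p, hp⟩ := exists_polynomial_near_of_continuousOn a b g g.continuous.continuousOn
    (δ / c) (by positivity)
  have h1 := hbound μ hμ p _ hp
  have h2 := hbound ν hν p _ hp
  rw [hpoly p] at h1
  have h3 : δ / c * μ.real univ + δ / c * ν.real univ ≤ δ := by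
    rw [← mul_add, div_mul_eq_mul_div, div_le_iff₀ hc]
    exact mul_le_mul_of_nonneg_left (by simp [c]) hδ.le
  rw [dist_comm, Real.dist_eq]
  rw [abs_le] at *
  constructor <;> linarith [h1.1, h1.2, h2.1, h2.2]

/-- The product of consecutive Wallis integrals. -/
theorem integral_cos_pow_mul_integral_sin_pow (n : ℕ) :
    (∫ x in (0 : ℝ)..π / 2, cos x ^ n) * ∫ x in (0 : ℝ)..π / 2, sin x ^ (n + 1) =
      π / 2 * (1 / (n + 1)) := by
  have hcos : ∀ n : ℕ, ∫ x in (0 : ℝ)..π / 2, cos x ^ n = ∫ x in (0 : ℝ)..π / 2, sin x ^ n := by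
    intro n
    have h := intervalIntegral.integral_comp_sub_left (a := 0) (b := π / 2)
      (fun x => cos x ^ n) (π / 2)
    simp only [cos_pi_div_two_sub, sub_self, sub_zero] at h
    exact h.symm
  rw [hcos]
  induction n with
  | zero => simp
  | succ n ih =>
    have h := integral_sin_pow (a := 0) (b := π / 2) n
    rw [sin_zero, cos_pi_div_two, zero_pow (Nat.succ_ne_zero n)] at h
    rw [h]
    have hn : (n : ℝ) + 1 ≠ 0 := by positivity
    have hn2 : (n : ℝ) + 2 ≠ 0 := by positivity
    push_cast
    field_simp at ih ⊢
    linear_combination ((n : ℝ) + 2) * ih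

/-- Lebesgue measure on the longitudes `φ` and colatitudes `t` of an octant of the sphere, without
the area density `sin t`. -/
def octantMeasure : Measure (ℝ × ℝ) :=
  (volume.restrict (Ioc 0 (π / 2))).prod (volume.restrict (Ioc 0 (π / 2)))

instance : IsFiniteMeasure octantMeasure := by
  unfold octantMeasure; infer_instance

theorem ae_octantMeasure :
    ∀ᵐ p ∂octantMeasure, p.1 ∈ Ioc 0 (π / 2) ∧ p.2 ∈ Ioc 0 (π / 2) := by
  rw [octantMeasure, Measure.prod_restrict]
  exact (ae_restrict_mem (measurableSet_Ioc.prod measurableSet_Ioc)).mono fun p hp => hp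

instance : IsFiniteMeasure
    (octantMeasure.withDensity fun p => ENNReal.ofReal (sin p.2)) := by
  refine isFiniteMeasure_withDensity_ofReal (Integrable.hasFiniteIntegral ?_)
  exact Integrable.of_bound (by fun_prop) 1 (ae_of_all _ fun p => abs_sin_le_one _)

theorem ae_octantMeasure_sin_nonneg : ∀ᵐ p ∂octantMeasure, 0 ≤ sin p.2 :=
  ae_octantMeasure.mono fun p hp =>
    sin_nonneg_of_nonneg_of_le_pi hp.2.1.le (by linarith [hp.2.2, pi_pos])

/-- On an octant of the sphere, with area element `sin t dφ dt`, the coordinate `cos φ sin t` is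
uniformly distributed. -/
theorem map_octantMeasure :
    (octantMeasure.withDensity fun p => ENNReal.ofReal (sin p.2)).map
      (fun p => cos p.1 * sin p.2) =
      ENNReal.ofReal (π / 2) • volume.restrict (Ioc 0 1) := by
  have hT : Measurable fun p : ℝ × ℝ => cos p.1 * sin p.2 := by fun_prop
  have : IsFiniteMeasure (ENNReal.ofReal (π / 2) • volume.restrict (Ioc (0 : ℝ) 1)) :=
    Measure.smul_finite _ ENNReal.ofReal_ne_top
  refine ext_of_forall_integral_pow_eq (a := 0) (b := 1) ?_ ?_ fun n => ?_
  · refine (ae_map_iff (p := fun x => x ∈ Icc (0 : ℝ) 1) hT.aemeasurable measurableSet_Icc).2 ?_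
    refine (withDensity_absolutelyContinuous _ _).ae_le (ae_octantMeasure.mono fun p hp => ?_)
    have h1 : 0 ≤ cos p.1 := cos_nonneg_of_neg_pi_div_two_le_of_le
      (by linarith [hp.1.1, pi_pos]) hp.1.2
    have h2 : 0 ≤ sin p.2 :=
      sin_nonneg_of_nonneg_of_le_pi hp.2.1.le (by linarith [hp.2.2, pi_pos])
    exact ⟨mul_nonneg h1 h2, mul_le_one₀ (cos_le_one _) h2 (sin_le_one _)⟩
  · exact Measure.ae_smul_measure
      ((ae_restrict_mem measurableSet_Ioc).mono fun x hx => Ioc_subset_Icc_self hx) _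
  · rw [integral_map hT.aemeasurable (by fun_prop), integral_smul_measure,
      ENNReal.toReal_ofReal (by positivity), ← intervalIntegral.integral_of_le zero_le_one,
      integral_pow, integral_withDensity_eq_integral_toReal_smul (by fun_prop) (by simp)]
    have h1 : ∫ p, (ENNReal.ofReal (sin p.2)).toReal • (cos p.1 * sin p.2) ^ n ∂octantMeasure =
        ∫ p : ℝ × ℝ, cos p.1 ^ n * sin p.2 ^ (n + 1) ∂octantMeasure :=
      integral_congr_ae (ae_octantMeasure_sin_nonneg.mono fun p hp => by
        simp only [ENNReal.toReal_ofReal hp, smul_eq_mul]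
        ring)
    rw [h1, octantMeasure, integral_prod_mul (fun x => cos x ^ n) (fun x => sin x ^ (n + 1)),
      ← intervalIntegral.integral_of_le (by positivity),
      ← intervalIntegral.integral_of_le (by positivity), integral_cos_pow_mul_integral_sin_pow]
    simp

theorem integrable_octantMeasure {g : ℝ → ℝ} (hg : IntervalIntegrable g volume 0 1) :
    Integrable (fun p : ℝ × ℝ => sin p.2 * g (cos p.1 * sin p.2)) octantMeasure := by
  have hT : Measurable fun p : ℝ × ℝ => cos p.1 * sin p.2 := by fun_prop
  have h1 : Integrable g ((octantMeasure.withDensity fun p => ENNReal.ofReal (sin p.2)).map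
      (fun p => cos p.1 * sin p.2)) := by
    rw [map_octantMeasure]
    exact ((intervalIntegrable_iff_integrableOn_Ioc_of_le zero_le_one).1 hg).smul_measure
      ENNReal.ofReal_ne_top
  have h2 := (integrable_map_measure h1.aestronglyMeasurable hT.aemeasurable).1 h1
  rw [integrable_withDensity_iff_integrable_smul' (by fun_prop) (by simp)] at h2
  exact h2.congr (ae_octantMeasure_sin_nonneg.mono fun p hp => by simp [ENNReal.toReal_ofReal hp])

theorem integral_octantMeasure {g : ℝ → ℝ} (hg : IntervalIntegrable g volume 0 1) :
    ∫ p : ℝ × ℝ, sin p.2 * g (cos p.1 * sin p.2) ∂octantMeasure =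
      π / 2 * ∫ u in (0 : ℝ)..1, g u := by
  have hT : Measurable fun p : ℝ × ℝ => cos p.1 * sin p.2 := by fun_prop
  have h1 : AEStronglyMeasurable g
      ((octantMeasure.withDensity fun p => ENNReal.ofReal (sin p.2)).map
        (fun p => cos p.1 * sin p.2)) := by
    rw [map_octantMeasure]
    have h := (intervalIntegrable_iff_integrableOn_Ioc_of_le zero_le_one).1 hg
    exact h.aestronglyMeasurable.smul_measure _
  have h2 := integral_map hT.aemeasurable h1
  rw [map_octantMeasure, integral_smul_measure, ENNReal.toReal_ofReal (by positivity),
    ← intervalIntegral.integral_of_le zero_le_one,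
    integral_withDensity_eq_integral_toReal_smul (by fun_prop) (by simp)] at h2
  rw [← smul_eq_mul (π / 2), h2]
  exact integral_congr_ae
    (ae_octantMeasure_sin_nonneg.mono fun p hp => by simp [ENNReal.toReal_ofReal hp])

/-! ### Spherical means -/

theorem arccos_cos_arccos (u : ℝ) : arccos (cos (arccos u)) = arccos u :=
  arccos_cos (arccos_nonneg u) (arccos_le_pi u)

theorem continuous_expPoint_uncurry : Continuous fun p : ℝ × S2 => expPoint p.1 p.2 := by
  refine Continuous.subtype_mk ?_ _
  have h1 := continuous_pureQuat
  have h2 := Quaternion.continuous_coe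
  fun_prop

theorem continuous_sphereMean {f : S3 → ℝ} (hf : Continuous f) (q : S3) :
    Continuous (sphereMean f q) := by
  unfold sphereMean
  refine continuous_const.mul ?_
  have h := continuous_expPoint_uncurry
  exact continuous_integral_of_continuous (Y := ℝ) (Ω := S2) (μ := omega2) hf
    (φ := fun p => q * expPoint p.1 p.2) (by fun_prop)

theorem sphereMean_zero {f : S3 → ℝ} (q : S3) : sphereMean f q 0 = f q := by
  simp only [sphereMean, expPoint_zero, mul_one, integral_const, smul_eq_mul]
  rw [measureReal_def, omega2_univ, ENNReal.toReal_ofReal (by positivity), ← mul_assoc,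
    inv_mul_cancel₀ (by positivity), one_mul]

theorem sphereMean_arccos_neg {f : S3 → ℝ} (hf : Continuous f) (heven : ∀ p, f (-p) = f p)
    (q : S3) (u : ℝ) : sphereMean f q (arccos (-u)) = sphereMean f q (arccos u) := by
  have h1 := integral_haarS3_conj hf q (expPoint (arccos u) axisI)
  have h2 := integral_haarS3_conj hf q (-expPoint (arccos u) axisI)
  have h3 : ((-expPoint (arccos u) axisI : S3) : ℍ[ℝ]).re = -cos (arccos u) := by
    rw [← expPoint_re (arccos u) axisI]; rfl
  rw [expPoint_re, arccos_cos_arccos] at h1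
  rw [h3, arccos_neg, arccos_cos_arccos, ← arccos_neg] at h2
  have h4 : ∀ k : S3, q * (k * -expPoint (arccos u) axisI * k⁻¹) =
      -(q * (k * expPoint (arccos u) axisI * k⁻¹)) := fun k => by
    ext1
    simp only [Metric.unitSphere.coe_mul, coe_neg_sphere]
    have (a b c d : ℍ[ℝ]) : a * (b * -c * d) = -(a * (b * c * d)) := by
      rw [mul_neg, neg_mul, mul_neg]
    exact this _ _ _ _
  rw [← h1, ← h2]
  simp only [h4, heven]

/-- Averaging an even function of `v cos s` over a full turn. -/
theorem integral_angleMeasure_comp_cos {F : ℝ → ℝ} (hF : Continuous F)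
    (heven : ∀ u, F (-u) = F u) (v c : ℝ) :
    ∫ s, F (v * cos (s + c)) ∂angleMeasure = 2 / π * ∫ t in (0 : ℝ)..π / 2, F (v * sin t) := by
  set H : ℝ → ℝ := fun t => F (v * sin t)
  have hH : Continuous H := by fun_prop
  have hint : ∀ a b, IntervalIntegrable H volume a b := fun a b => hH.intervalIntegrable a b
  have hper : Function.Periodic H π := fun t => by simp [H, sin_add_pi, heven]
  have h1 : ∀ s, F (v * cos (s + c)) = H (s + (c + π / 2)) := by
    intro s
    simp only [H]
    rw [← add_assoc, sin_add_pi_div_two]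
  rw [integral_angleMeasure]
  simp only [h1]
  rw [intervalIntegral.integral_comp_add_right]
  have h2 : ∀ a, ∫ t in a..a + π, H t = 2 * ∫ t in (0 : ℝ)..π / 2, H t := by
    intro a
    rw [hper.intervalIntegral_add_eq a 0, zero_add,
      ← intervalIntegral.integral_add_adjacent_intervals (hint 0 (π / 2)) (hint (π / 2) π)]
    have h3 := intervalIntegral.integral_comp_sub_left (a := 0) (b := π / 2) H π
    rw [sub_zero, show π - π / 2 = π / 2 by ring] at h3
    rw [← h3]
    simp only [H, sin_pi_sub]
    ring
  have h4 : ∫ t in 0 + (c + π / 2)..2 * π + (c + π / 2), H t =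
      4 * ∫ t in (0 : ℝ)..π / 2, H t := by
    rw [← intervalIntegral.integral_add_adjacent_intervals (hint _ (0 + (c + π / 2) + π))
      (hint _ _), h2, show 2 * π + (c + π / 2) = 0 + (c + π / 2) + π + π by ring, h2]
    ring
  rw [h4]
  field_simp
  ring

/-- The average of the spherical means of `f` over the points of a great circle at distance
`arccos v` from the centre, as an integral over a quarter of the circle. -/
def circleSphereMean (f : S3 → ℝ) (q : S3) (v : ℝ) : ℝ :=
  2 / π * ∫ t in (0 : ℝ)..π / 2, sphereMean f q (arccos (v * sin t))

theorem integral_sphereMean_cos {f : S3 → ℝ} (hf : Continuous f) (heven : ∀ p, f (-p) = f p)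
    (q : S3) (v c : ℝ) : ∫ s, sphereMean f q (arccos (v * cos (s + c))) ∂angleMeasure =
      circleSphereMean f q v :=
  integral_angleMeasure_comp_cos ((continuous_sphereMean hf q).comp continuous_arccos)
    (sphereMean_arccos_neg hf heven q) v c

theorem intervalIntegrable_inv_sqrt_one_sub_sq :
    IntervalIntegrable (fun u : ℝ => 1 / √(1 - u ^ 2)) volume 0 1 := by
  rw [intervalIntegrable_iff_integrableOn_Ioc_of_le zero_le_one]
  exact intervalIntegral.integrableOn_deriv_of_nonneg continuous_arcsin.continuousOn
    (fun x hx => hasDerivAt_arcsin (by linarith [hx.1]) (by linarith [hx.2]))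
    (fun x hx => by positivity)

/-- The spherical means about `q`, as a function of the cosine `u` of the radius, have a derivative
for `|u| < 1`, with at most an inverse square root singularity at the ends. -/
theorem exists_hasDerivAt_sphereMean {f : S3 → ℝ} (hf : ContMDiff (𝓡 3) 𝓘(ℝ, ℝ) 1 f) (q : S3) :
    ∃ D : ℝ → ℝ, Measurable D ∧ (∃ B, 0 ≤ B ∧ ∀ u, |D u| ≤ B * (1 / √(1 - u ^ 2))) ∧
      ∀ u ∈ Ioo (-1 : ℝ) 1, HasDerivAt (fun u => sphereMean f q (arccos u)) (D u) u := by
  have hfc := hf.continuous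
  obtain ⟨g, hg, hfg⟩ := exists_continuous_hasDerivAt_expPoint hf axisI
  obtain ⟨B, hB⟩ := exists_abs_le_of_continuous hg
  set N' : ℝ → ℝ := fun ψ => ∫ k, g (q * k * expPoint ψ axisI, k⁻¹) ∂haarS3
  have hN' : Continuous N' := by
    have := continuous_expPoint axisI
    exact continuous_integral_of_continuous (Y := ℝ) (Ω := S3) (μ := haarS3) hg
      (φ := fun p => (q * p.2 * expPoint p.1 axisI, p.2⁻¹)) (by fun_prop)
  have hN'B : ∀ ψ, |N' ψ| ≤ B := fun ψ => by
    simpa using norm_integral_le_of_norm_le_const (μ := haarS3) (C := B)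
      (f := fun k => g (q * k * expPoint ψ axisI, k⁻¹)) (ae_of_all _ fun k => hB _)
  refine ⟨fun u => N' (arccos u) * -(1 / √(1 - u ^ 2)), ?_,
    ⟨B, (abs_nonneg _).trans (hN'B 0), fun u => ?_⟩, fun u hu => ?_⟩
  · have := hN'.measurable
    have := continuous_arccos.measurable
    fun_prop
  · rw [abs_mul, abs_neg, abs_of_nonneg (show 0 ≤ 1 / √(1 - u ^ 2) by positivity)]
    exact mul_le_mul_of_nonneg_right (hN'B _) (by positivity)
  · have hM : (fun u => sphereMean f q (arccos u)) = fun u =>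
        ∫ k, f (q * k * expPoint (arccos u) axisI * k⁻¹) ∂haarS3 := by
      ext u
      have h := integral_haarS3_conj hfc q (expPoint (arccos u) axisI)
      rw [expPoint_re, arccos_cos_arccos] at h
      rw [← h]
      simp only [mul_assoc]
    rw [hM]
    exact (hasDerivAt_integral_expPoint hfc hg hfg haarS3 (measurable_const_mul q)
      measurable_inv (arccos u)).comp u
        (hasDerivAt_arccos (by linarith [hu.1]) (by linarith [hu.2]))

theorem intervalIntegrable_of_abs_le_inv_sqrt {D : ℝ → ℝ} (hD : Measurable D) {B : ℝ}
    (hB : ∀ u, |D u| ≤ B * (1 / √(1 - u ^ 2))) : IntervalIntegrable D volume 0 1 :=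
  (intervalIntegrable_inv_sqrt_one_sub_sq.const_mul B).mono_fun' hD.aestronglyMeasurable
    (ae_of_all _ hB)

/-- Differentiation of the averaged spherical means under the integral sign. -/
theorem hasDerivAt_circleSphereMean {f : S3 → ℝ} (hf : Continuous f) {q : S3} {D : ℝ → ℝ}
    (hD : Measurable D) {B : ℝ} (hB0 : 0 ≤ B) (hB : ∀ u, |D u| ≤ B * (1 / √(1 - u ^ 2)))
    (hderiv : ∀ u ∈ Ioo (-1 : ℝ) 1, HasDerivAt (fun u => sphereMean f q (arccos u)) (D u) u)
    {v : ℝ} (hv0 : 0 < v) (hv : v < 1) :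
    HasDerivAt (circleSphereMean f q)
      (2 / π * ∫ t in (0 : ℝ)..π / 2, sin t * D (v * sin t)) v := by
  have hM : Continuous fun u => sphereMean f q (arccos u) :=
    (continuous_sphereMean hf q).comp continuous_arccos
  obtain ⟨c, hvc, hc⟩ := exists_between hv
  have hc0 : 0 < c := hv0.trans hvc
  -- for `|x| < c` and all `t` the points `x sin t` stay away from `±1`
  have hx : ∀ x ∈ Ioo (-c) c, ∀ t, |x * sin t| < c := by
    intro x hx t
    rw [abs_mul]
    calc |x| * |sin t| ≤ |x| * 1 := by gcongr; exact abs_sin_le_one t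
      _ < c := by rw [mul_one]; exact abs_lt.2 hx
  have hmem : ∀ x ∈ Ioo (-c) c, ∀ t, x * sin t ∈ Ioo (-1 : ℝ) 1 := fun x hx' t =>
    abs_lt.1 ((hx x hx' t).trans hc)
  refine HasDerivAt.const_mul (2 / π) ?_
  refine (intervalIntegral.hasDerivAt_integral_of_dominated_loc_of_deriv_le
    (F := fun x t => sphereMean f q (arccos (x * sin t)))
    (F' := fun x t => sin t * D (x * sin t))
    (bound := fun _ => B * (1 / √(1 - c ^ 2))) (Ioo_mem_nhds (by linarith : -c < v) hvc)
    (Filter.Eventually.of_forall fun x => ?_) ?_ ?_ ?_ (by simp) ?_).2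
  · exact (hM.comp (by fun_prop : Continuous fun t => x * sin t)).aestronglyMeasurable
  · exact (hM.comp (by fun_prop : Continuous fun t => v * sin t)).intervalIntegrable _ _
  · have : Measurable fun t => sin t * D (v * sin t) := by fun_prop
    exact this.aestronglyMeasurable
  · refine ae_of_all _ fun t _ x hx' => ?_
    rw [Real.norm_eq_abs, abs_mul]
    have h1 : (x * sin t) ^ 2 ≤ c ^ 2 := by
      rw [← sq_abs]
      exact pow_le_pow_left₀ (abs_nonneg _) (hx x hx' t).le 2
    have h2 : 0 < 1 - c ^ 2 := by nlinarith
    calc |sin t| * |D (x * sin t)| ≤ 1 * (B * (1 / √(1 - (x * sin t) ^ 2))) := by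
          gcongr
          · exact abs_sin_le_one t
          · exact hB _
      _ ≤ B * (1 / √(1 - c ^ 2)) := by
          rw [one_mul]
          gcongr
  · refine ae_of_all _ fun t _ x hx' => ?_
    have h1 : HasDerivAt (fun x => x * sin t) (sin t) x := by
      simpa using (hasDerivAt_id x).mul_const (sin t)
    have h2 := (hderiv _ (hmem x hx' t)).comp x h1
    rwa [mul_comm] at h2

/-- The substitution `u = v sin t` turns the average over a great circle into an Abel integral. -/
theorem circleSphereMean_eq_abel {f : S3 → ℝ} (hf : Continuous f) (q : S3) {v : ℝ} (hv : 0 < v) :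
    IntervalIntegrable (fun u => sphereMean f q (arccos u) / √(v ^ 2 - u ^ 2)) volume 0 v ∧
      circleSphereMean f q v =
        2 / π * ∫ u in (0 : ℝ)..v, sphereMean f q (arccos u) / √(v ^ 2 - u ^ 2) := by
  have hM : Continuous fun u => sphereMean f q (arccos u) :=
    (continuous_sphereMean hf q).comp continuous_arccos
  have hpi := pi_pos
  have hsin : ∀ t ∈ Ioo (0 : ℝ) (π / 2), 0 < sin t ∧ 0 < cos t := fun t ht =>
    ⟨sin_pos_of_pos_of_lt_pi ht.1 (by linarith [ht.2]),
      cos_pos_of_mem_Ioo ⟨by linarith [ht.1], ht.2⟩⟩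
  have himage : (fun t => v * sin t) '' Ioo 0 (π / 2) = Ioo 0 v := by
    ext u
    constructor
    · rintro ⟨t, ht, rfl⟩
      obtain ⟨h1, h2⟩ := hsin t ht
      have h3 : sin t < 1 := by nlinarith [sin_sq_add_cos_sq t]
      exact ⟨by positivity, by nlinarith⟩
    · rintro ⟨h1, h2⟩
      have h3 : u / v < 1 := (div_lt_one hv).2 h2
      have h4 : 0 < u / v := by positivity
      refine ⟨arcsin (u / v), ⟨arcsin_pos.2 h4, arcsin_lt_pi_div_two.2 h3⟩, ?_⟩
      simp only
      rw [sin_arcsin (by linarith) h3.le]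
      field_simp
  have hinj : InjOn (fun t => v * sin t) (Ioo 0 (π / 2)) := by
    intro s hs t ht h
    refine injOn_sin ⟨by linarith [hs.1], hs.2.le⟩ ⟨by linarith [ht.1], ht.2.le⟩ ?_
    exact mul_left_cancel₀ hv.ne' h
  have hder : ∀ t ∈ Ioo (0 : ℝ) (π / 2),
      HasDerivWithinAt (fun t => v * sin t) (v * cos t) (Ioo 0 (π / 2)) t :=
    fun t _ => ((hasDerivAt_sin t).const_mul v).hasDerivWithinAt
  have hval : ∀ t ∈ Ioo (0 : ℝ) (π / 2), |v * cos t| •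
      (sphereMean f q (arccos (v * sin t)) / √(v ^ 2 - (v * sin t) ^ 2)) =
        sphereMean f q (arccos (v * sin t)) := by
    intro t ht
    obtain ⟨-, h2⟩ := hsin t ht
    have h3 : v ^ 2 - (v * sin t) ^ 2 = (v * cos t) ^ 2 := by
      linear_combination (-v ^ 2) * sin_sq_add_cos_sq t
    have h4 : 0 < v * cos t := by positivity
    rw [h3, sqrt_sq h4.le, abs_of_pos h4, smul_eq_mul]
    field_simp
  constructor
  · rw [intervalIntegrable_iff_integrableOn_Ioo_of_le hv.le, ← himage,
      integrableOn_image_iff_integrableOn_abs_deriv_smul measurableSet_Ioo hder hinj,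
      integrableOn_congr_fun hval measurableSet_Ioo]
    exact ((hM.comp (by fun_prop : Continuous fun t => v * sin t)).integrableOn_Icc (a := 0)
      (b := π / 2)).mono_set Ioo_subset_Icc_self
  · rw [circleSphereMean, intervalIntegral.integral_of_le (by positivity),
      intervalIntegral.integral_of_le hv.le, integral_Ioc_eq_integral_Ioo,
      integral_Ioc_eq_integral_Ioo, ← himage,
      integral_image_eq_integral_abs_deriv_smul measurableSet_Ioo hder hinj,
      setIntegral_congr_fun measurableSet_Ioo hval]

/-! ### The dual Radon transform -/

theorem re_inv_mul (q p : S3) : ((q⁻¹ * p : S3) : ℍ[ℝ]).re = ⟪(q : ℍ[ℝ]), (p : ℍ[ℝ])⟫ := by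
  rw [Metric.unitSphere.coe_mul, coe_inv_S3, Quaternion.inner_def]
  simp

/-- Polar coordinates in the plane, including the origin. -/
theorem exists_sqrt_mul_cos_sin (x y : ℝ) :
    ∃ c, x = √(x ^ 2 + y ^ 2) * cos c ∧ y = √(x ^ 2 + y ^ 2) * sin c := by
  by_cases h : x ^ 2 + y ^ 2 = 0
  · have hx : x = 0 := by nlinarith [sq_nonneg x, sq_nonneg y]
    have hy : y = 0 := by nlinarith [sq_nonneg x, sq_nonneg y]
    exact ⟨0, by simp [hx, hy]⟩
  · have hpos : 0 < x ^ 2 + y ^ 2 := lt_of_le_of_ne (by positivity) (Ne.symm h)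
    obtain ⟨c, h1, h2⟩ := exists_cos_sin (x := x / √(x ^ 2 + y ^ 2)) (y := y / √(x ^ 2 + y ^ 2)) (by
      rw [div_pow, div_pow, sq_sqrt hpos.le, ← add_div, div_self h])
    have h3 : √(x ^ 2 + y ^ 2) ≠ 0 := (sqrt_pos.2 hpos).ne'
    exact ⟨c, by rw [h1]; field_simp, by rw [h2]; field_simp⟩

/-- Seen from `q`, a great circle at distance `arccos v` is traversed with
`⟪q, p⟫ = v cos (t - c)`. -/
theorem exists_inner_greatFrame_pt (q q₁ q₂ : S3) (h : ⟪(q₁ : ℍ[ℝ]), (q₂ : ℍ[ℝ])⟫ = 0) :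
    ∃ v c, 0 ≤ v ∧ v ≤ 1 ∧ distS3 q (greatCircle q₁ q₂) = arccos v ∧
      ∀ t, ⟪(q : ℍ[ℝ]), ((greatFrame q₁ q₂ h).pt t : ℍ[ℝ])⟫ = v * cos (t + c) := by
  obtain ⟨c, hx, hy⟩ := exists_sqrt_mul_cos_sin ⟪(q : ℍ[ℝ]), (q₁ : ℍ[ℝ])⟫ ⟪(q : ℍ[ℝ]), (q₂ : ℍ[ℝ])⟫
  set v := √(⟪(q : ℍ[ℝ]), (q₁ : ℍ[ℝ])⟫ ^ 2 + ⟪(q : ℍ[ℝ]), (q₂ : ℍ[ℝ])⟫ ^ 2)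
  have hv : 0 ≤ v := sqrt_nonneg _
  have hin : ∀ t, ⟪(q : ℍ[ℝ]), ((greatFrame q₁ q₂ h).pt t : ℍ[ℝ])⟫ = v * cos (t + -c) := by
    intro t
    simp only [CircleFrame.pt, greatFrame, zero_add, inner_add_right, real_inner_smul_right]
    rw [hx, hy, ← sub_eq_add_neg, cos_sub]
    ring
  refine ⟨v, -c, hv, ?_, ?_, hin⟩
  · have h1 := real_inner_le_norm (q : ℍ[ℝ]) ((greatFrame q₁ q₂ h).pt c : ℍ[ℝ])
    rw [hin, norm_eq_of_mem_sphere, norm_eq_of_mem_sphere, add_neg_cancel, cos_zero] at h1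
    linarith
  · rw [distS3, ← range_greatFrame q₁ q₂ h]
    refine IsLeast.csInf_eq ⟨⟨_, mem_range_self c, ?_⟩, ?_⟩
    · simp only [hin, add_neg_cancel, cos_zero, mul_one]
    · rintro _ ⟨_, ⟨t, rfl⟩, rfl⟩
      simp only [hin]
      refine antitone_arccos ?_
      calc v * cos (t + -c) ≤ v * 1 := by gcongr; exact cos_le_one _
        _ = v := mul_one v

theorem continuous_circleFrame_pt {E : Type*} [NormedAddCommGroup E] [InnerProductSpace ℝ E]
    (γ : CircleFrame E) : Continuous γ.pt :=
  Continuous.subtype_mk (by fun_prop) _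

/-- The mean of the Radon transform over the great circles at a given distance from `q` is an
average of spherical means about `q`: for each point of the circle the rotations about `q` sweep
out a sphere. -/
theorem dualRadon_radon {f : S3 → ℝ} (hf : Continuous f) (q q₁ q₂ : S3)
    (h : ⟪(q₁ : ℍ[ℝ]), (q₂ : ℍ[ℝ])⟫ = 0) :
    dualRadon (radon f) q (greatCircle q₁ q₂) =
      ∫ t, sphereMean f q (arccos ⟪(q : ℍ[ℝ]), ((greatFrame q₁ q₂ h).pt t : ℍ[ℝ])⟫)
        ∂angleMeasure := by
  have hpt : ∀ (k : S3) (t : ℝ), ((q * k * q⁻¹ * (greatFrame q₁ q₂ h).pt t * k⁻¹ : S3) : ℍ[ℝ]) =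
      cos t • ((q * k * q⁻¹ * q₁ * k⁻¹ : S3) : ℍ[ℝ]) +
        sin t • ((q * k * q⁻¹ * q₂ * k⁻¹ : S3) : ℍ[ℝ]) := by
    intro k t
    simp only [Metric.unitSphere.coe_mul, CircleFrame.pt, greatFrame, zero_add]
    simp only [mul_add, add_mul, mul_smul_comm, smul_mul_assoc]
  have himage : ∀ k : S3, (fun p => q * k * q⁻¹ * p * k⁻¹) '' greatCircle q₁ q₂ =
      greatCircle (q * k * q⁻¹ * q₁ * k⁻¹) (q * k * q⁻¹ * q₂ * k⁻¹) := by
    intro k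
    ext p
    rw [← range_greatFrame q₁ q₂ h, ← range_comp]
    refine exists_congr fun t => ?_
    rw [← hpt, Subtype.coe_inj]
    exact eq_comm
  have horth : ∀ k : S3, ⟪((q * k * q⁻¹ * q₁ * k⁻¹ : S3) : ℍ[ℝ]),
      ((q * k * q⁻¹ * q₂ * k⁻¹ : S3) : ℍ[ℝ])⟫ = 0 := by
    intro k
    rw [Metric.unitSphere.coe_mul _ k⁻¹, Metric.unitSphere.coe_mul _ q₁,
      Metric.unitSphere.coe_mul _ k⁻¹, Metric.unitSphere.coe_mul _ q₂,
      inner_mul_mul _ _ _ _ (norm_eq_of_mem_sphere _) (norm_eq_of_mem_sphere _), h]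
  have h1 : ∀ k : S3, radon f ((fun p => q * k * q⁻¹ * p * k⁻¹) '' greatCircle q₁ q₂) =
      ∫ t, f (q * (k * (q⁻¹ * (greatFrame q₁ q₂ h).pt t) * k⁻¹)) ∂angleMeasure := by
    intro k
    rw [himage, radon_greatCircle_eq_integral f _ _ (horth k)]
    refine integral_congr_ae (ae_of_all _ fun t => congrArg f ?_)
    ext1
    have h2 : q * (k * (q⁻¹ * (greatFrame q₁ q₂ h).pt t) * k⁻¹) =
        q * k * q⁻¹ * (greatFrame q₁ q₂ h).pt t * k⁻¹ := by simp only [mul_assoc]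
    rw [h2, hpt]
    simp [CircleFrame.pt, greatFrame]
  have hcont := continuous_circleFrame_pt (greatFrame q₁ q₂ h)
  rw [dualRadon]
  simp only [h1]
  rw [integral_integral_swap]
  · simp only [integral_haarS3_conj hf, re_inv_mul]
  · refine integrable_comp_of_continuous hf
      (φ := fun p : S3 × ℝ => q * (p.1 * (q⁻¹ * (greatFrame q₁ q₂ h).pt p.2) * p.1⁻¹)) ?_
    exact Continuous.measurable (by fun_prop)

theorem dualRadon_radon_eq_abel {f : S3 → ℝ} (hf : Continuous f) (heven : ∀ p, f (-p) = f p)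
    (q : S3) {C : Set S3} (hC : IsGreatCircle C) (hdist : distS3 q C < π / 2) :
    IntervalIntegrable
        (fun u => sphereMean f q (arccos u) / √(cos (distS3 q C) ^ 2 - u ^ 2))
        volume 0 (cos (distS3 q C)) ∧
      dualRadon (radon f) q C =
        2 / π * ∫ u in (0 : ℝ)..cos (distS3 q C),
          sphereMean f q (arccos u) / √(cos (distS3 q C) ^ 2 - u ^ 2) := by
  obtain ⟨q₁, q₂, h, rfl⟩ := hC
  obtain ⟨v, c, hv0, hv1, hd, hin⟩ := exists_inner_greatFrame_pt q q₁ q₂ h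
  rw [hd] at hdist ⊢
  have hv : 0 < v := arccos_lt_pi_div_two.1 hdist
  rw [cos_arccos (by linarith) hv1, dualRadon_radon hf q q₁ q₂ h]
  simp only [hin]
  rw [integral_sphereMean_cos hf heven]
  exact circleSphereMean_eq_abel hf q hv

/-! ### Torus averages and the inversion formula -/

theorem re_expPoint_mul (t ψ s : ℝ) :
    ((expPoint t axisI * expPoint ψ axisK * expPoint s axisI : S3) : ℍ[ℝ]).re =
      cos ψ * cos (t + s) := by
  rw [cos_add]
  simp [expPoint, axisI, axisK]
  ring

/-- The uniform probability measure on the angles of a torus. -/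
def torusMeasure : Measure (ℝ × ℝ) := angleMeasure.prod angleMeasure

instance : IsProbabilityMeasure torusMeasure := by
  unfold torusMeasure; infer_instance

theorem continuous_torus_left (q : S3) :
    Continuous fun p : S3 × ℝ × ℝ => q * p.1 * expPoint (p.2.1 / 2) axisI := by
  have := continuous_expPoint axisI
  fun_prop

theorem continuous_torus_right :
    Continuous fun p : S3 × ℝ × ℝ => expPoint p.2.2 axisI * p.1⁻¹ := by
  have := continuous_expPoint axisI
  fun_prop

theorem angleDensity_eq_torus {f : S3 → ℝ} (hf : Continuous f) (q k : S3) (θ : ℝ) :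
    angleDensity f (rotate k axisI) (rotate q (rotate k axisI)) θ =
      ∫ p : ℝ × ℝ, f (q * k * expPoint (p.1 / 2) axisI * expPoint (θ / 2) axisK *
        (expPoint p.2 axisI * k⁻¹)) ∂torusMeasure := by
  rw [← rotate_mul, angleDensity_rotate, torusMeasure, integral_prod]
  have h1 := (continuous_torus_left q).comp (Continuous.prodMk_right k)
  have h2 := continuous_torus_right.comp (Continuous.prodMk_right k)
  exact integrable_comp_of_continuous hf
    ((h1.mul (continuous_const (y := expPoint (θ / 2) axisK))).mul h2).measurable

theorem integral_haarS3_torus {f : S3 → ℝ} (hf : Continuous f) (heven : ∀ p, f (-p) = f p)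
    (q : S3) (ψ : ℝ) :
    ∫ k, ∫ p : ℝ × ℝ, f (q * k * expPoint (p.1 / 2) axisI * expPoint ψ axisK *
      (expPoint p.2 axisI * k⁻¹)) ∂torusMeasure ∂haarS3 = circleSphereMean f q (cos ψ) := by
  have h1 : Continuous fun p : S3 × ℝ × ℝ => q * p.1 * expPoint (p.2.1 / 2) axisI *
      expPoint ψ axisK * (expPoint p.2.2 axisI * p.1⁻¹) :=
    ((continuous_torus_left q).mul continuous_const).mul continuous_torus_right
  have h2 : ∀ (k : S3) (p : ℝ × ℝ), q * k * expPoint (p.1 / 2) axisI * expPoint ψ axisK *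
      (expPoint p.2 axisI * k⁻¹) = q * (k * (expPoint (p.1 / 2) axisI * expPoint ψ axisK *
        expPoint p.2 axisI) * k⁻¹) := fun k p => by simp only [mul_assoc]
  have h3 : Continuous fun p : S3 => sphereMean f q (arccos (p : ℍ[ℝ]).re) := by
    have h := continuous_sphereMean hf q
    have h' := Quaternion.continuous_re
    fun_prop
  have h4 : Continuous fun p : ℝ × ℝ => expPoint (p.1 / 2) axisI * expPoint ψ axisK *
      expPoint p.2 axisI := by
    have := continuous_expPoint axisI
    fun_prop
  have h5 := integrable_comp_of_continuous (μ := torusMeasure) h3 h4.measurable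
  rw [integral_integral_swap (integrable_comp_of_continuous hf h1.measurable)]
  simp only [h2, integral_haarS3_conj hf]
  rw [torusMeasure] at h5 ⊢
  rw [integral_prod _ h5]
  have h6 : ∀ x y, cos ψ * cos (x / 2 + y) = cos ψ * cos (y + x / 2) := fun x y => by
    rw [add_comm]
  simp only [re_expPoint_mul, h6, integral_sphereMean_cos hf heven, integral_const, probReal_univ,
    one_smul]

/-- The mean of the Radon transforms `(ℛf)(h, -qhq*)` over all `h` is the mean of `f` over the
great sphere about `q`. -/
theorem integral_radon_fibre_neg_rotate {f : S3 → ℝ} (hf : Continuous f) (q : S3) :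
    Continuous (fun h => radon f (fibre h (-rotate q h))) ∧
      ∫ h, radon f (fibre h (-rotate q h)) ∂omega2 = 4 * π * sphereMean f q (π / 2) := by
  have h1 : Continuous fun p : S3 × ℝ => q * p.1 * expPoint (π / 2) axisK *
      (expPoint p.2 axisI * p.1⁻¹) := by
    have := continuous_expPoint axisI
    fun_prop
  have h2 : ∀ (k : S3) (s : ℝ), q * k * expPoint (π / 2) axisK * (expPoint s axisI * k⁻¹) =
      q * (k * (expPoint 0 axisI * expPoint (π / 2) axisK * expPoint s axisI) * k⁻¹) := by
    intro k s
    rw [expPoint_zero]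
    simp only [mul_assoc, one_mul]
  have hcont : Continuous (fun h => radon f (fibre h (-rotate q h))) := by
    refine continuous_of_comp_rotate axisI ?_
    simp only [radon_fibre_neg_rotate]
    exact continuous_integral_of_continuous hf h1
  refine ⟨hcont, ?_⟩
  rw [integral_omega2 axisI hcont]
  simp only [radon_fibre_neg_rotate]
  rw [integral_integral_swap (integrable_comp_of_continuous hf h1.measurable)]
  simp only [h2, integral_haarS3_conj hf, re_expPoint_mul, cos_pi_div_two, zero_mul, arccos_zero,
    integral_const, probReal_univ, one_smul]

/-- Differentiation of the angle density function in `cos θ`, pointwise in `h` and on average. The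
mean over `h` is a mean over the circles at distance `θ / 2` from `q`, and
`cos θ = 2 cos² (θ / 2) - 1`. -/
theorem angleDensityDeriv_properties {f : S3 → ℝ} (hf : ContMDiff (𝓡 3) 𝓘(ℝ, ℝ) 1 f)
    (heven : ∀ p, f (-p) = f p) (q : S3) {θ : ℝ} (hθ : θ ∈ Ioo 0 π) :
    (∀ h : S2,
      DifferentiableAt ℝ (fun x => angleDensity f h (rotate q h) (arccos x)) (cos θ)) ∧
    Continuous (fun h : S2 => angleDensityDeriv f h (rotate q h) θ) ∧
    ∀ G', HasDerivAt (circleSphereMean f q) G' (cos (θ / 2)) →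
      (∫ h : S2, angleDensityDeriv f h (rotate q h) θ ∂omega2) * cos (θ / 2) = π * G' := by
  have hfc := hf.continuous
  obtain ⟨g, hg, hfg⟩ := exists_continuous_hasDerivAt_expPoint hf axisK
  have hsin : 0 < sin θ := sin_pos_of_mem_Ioo hθ
  have hcos1 : -1 < cos θ := by nlinarith [sin_sq_add_cos_sq θ, neg_one_le_cos θ, cos_le_one θ]
  have hcos2 : cos θ < 1 := by nlinarith [sin_sq_add_cos_sq θ, neg_one_le_cos θ, cos_le_one θ]
  -- the derivative of the torus mean in `ψ = θ / 2`
  set A' : S3 → ℝ := fun k => ∫ p : ℝ × ℝ, g (q * k * expPoint (p.1 / 2) axisI *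
    expPoint (θ / 2) axisK, expPoint p.2 axisI * k⁻¹) ∂torusMeasure
  have hA'cont : Continuous A' :=
    continuous_integral_of_continuous hg (φ := fun p : S3 × ℝ × ℝ =>
      (q * p.1 * expPoint (p.2.1 / 2) axisI * expPoint (θ / 2) axisK,
        expPoint p.2.2 axisI * p.1⁻¹))
      (((continuous_torus_left q).mul continuous_const).prodMk continuous_torus_right)
  have harccos : HasDerivAt (fun x => arccos x / 2) (-(1 / sin θ) / 2) (cos θ) := by
    have h := (hasDerivAt_arccos hcos1.ne' hcos2.ne).div_const 2
    rwa [← sin_arccos, arccos_cos hθ.1.le hθ.2.le] at h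
  have hpoint : ∀ k : S3, HasDerivAt (fun x => angleDensity f (rotate k axisI)
      (rotate q (rotate k axisI)) (arccos x)) (A' k * (-(1 / sin θ) / 2)) (cos θ) := by
    intro k
    simp only [angleDensity_eq_torus hfc]
    have h := hasDerivAt_integral_expPoint hfc hg hfg torusMeasure
      ((continuous_torus_left q).comp (Continuous.prodMk_right k)).measurable
      (continuous_torus_right.comp (Continuous.prodMk_right k)).measurable (θ / 2)
    have h' : arccos (cos θ) / 2 = θ / 2 := by rw [arccos_cos hθ.1.le hθ.2.le]
    rw [← h'] at h
    have h2 := h.comp (cos θ) harccos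
    rw [h'] at h2
    exact h2
  have hval : ∀ k : S3, angleDensityDeriv f (rotate k axisI) (rotate q (rotate k axisI)) θ =
      A' k * (-(1 / sin θ) / 2) := fun k => (hpoint k).deriv
  have hcont : Continuous (fun h : S2 => angleDensityDeriv f h (rotate q h) θ) := by
    refine continuous_of_comp_rotate axisI ?_
    simp only [hval]
    exact hA'cont.mul continuous_const
  refine ⟨fun h => ?_, hcont, fun G' hG' => ?_⟩
  · obtain ⟨k, rfl⟩ := exists_rotate_eq axisI h
    exact (hpoint k).differentiableAt
  · rw [integral_omega2 axisI hcont]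
    simp only [hval]
    rw [integral_mul_const]
    -- both sides differentiate the mean over all `h` and over the torus
    have h1 : HasDerivAt (fun ψ => circleSphereMean f q (cos ψ)) (∫ k, A' k ∂haarS3) (θ / 2) := by
      have h := hasDerivAt_integral_expPoint hfc hg hfg (haarS3.prod torusMeasure)
        (continuous_torus_left q).measurable continuous_torus_right.measurable (θ / 2)
      have hval : (fun ψ => circleSphereMean f q (cos ψ)) = fun ψ =>
          ∫ p : S3 × ℝ × ℝ, f (q * p.1 * expPoint (p.2.1 / 2) axisI * expPoint ψ axisK *
            (expPoint p.2.2 axisI * p.1⁻¹)) ∂(haarS3.prod torusMeasure) := by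
        ext ψ
        rw [← integral_haarS3_torus hfc heven, integral_prod]
        exact integrable_comp_of_continuous hfc
          (((continuous_torus_left q).mul continuous_const).mul continuous_torus_right).measurable
      rw [hval]
      rw [integral_prod] at h
      · exact h
      · exact integrable_comp_of_continuous hg (((continuous_torus_left q).mul
          continuous_const).prodMk continuous_torus_right).measurable
    have h2 := h1.unique (hG'.comp (θ / 2) (hasDerivAt_cos (θ / 2)))
    have h3 : sin θ = 2 * sin (θ / 2) * cos (θ / 2) := by
      rw [← sin_two_mul]; congr 1; ring
    rw [h3] at hsin ⊢
    rw [h2]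
    have h4 : sin (θ / 2) ≠ 0 := fun h => by simp [h] at hsin
    have h5 : cos (θ / 2) ≠ 0 := fun h => by simp [h] at hsin
    field_simp
    ring

theorem mainTheorem4 (f : S3 → ℝ) (hf : ContMDiff (𝓡 3) 𝓘(ℝ, ℝ) 1 f)
    (heven : ∀ p, f (-p) = f p) (q : S3) :
    (∀ C : Set S3, IsGreatCircle C → distS3 q C < π / 2 →
      IntervalIntegrable
        (fun u => sphereMean f q (arccos u) / √(cos (distS3 q C) ^ 2 - u ^ 2))
        volume 0 (cos (distS3 q C)) ∧
      dualRadon (radon f) q C =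
        2 / π * ∫ u in (0 : ℝ)..cos (distS3 q C),
          sphereMean f q (arccos u) / √(cos (distS3 q C) ^ 2 - u ^ 2)) ∧
    Integrable (fun h : S2 => radon f (fibre h (-rotate q h))) omega2 ∧
    (∀ h : S2, ∀ θ ∈ Set.Ioo 0 π,
      DifferentiableAt ℝ (fun x => angleDensity f h (rotate q h) (arccos x)) (cos θ)) ∧
    (∀ θ ∈ Set.Ioo 0 π,
      Integrable (fun h : S2 => angleDensityDeriv f h (rotate q h) θ) omega2) ∧
    IntervalIntegrable
      (fun θ => (∫ h : S2, angleDensityDeriv f h (rotate q h) θ ∂omega2) * cos (θ / 2))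
      volume 0 π ∧
    f q = 1 / (4 * π) *
      ((∫ h : S2, radon f (fibre h (-rotate q h)) ∂omega2) +
        2 * ∫ θ in (0 : ℝ)..π,
          (∫ h : S2, angleDensityDeriv f h (rotate q h) θ ∂omega2) * cos (θ / 2)) := by
  have hfc := hf.continuous
  obtain ⟨hradon, hradon'⟩ := integral_radon_fibre_neg_rotate hfc q
  obtain ⟨D, hD, ⟨B, hB0, hB⟩, hderiv⟩ := exists_hasDerivAt_sphereMean hf q
  have hDint := intervalIntegrable_of_abs_le_inv_sqrt hD hB
  have hpi := pi_pos
  -- the derivative of the circle means, as a function of the angle `φ = θ / 2`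
  set H : ℝ → ℝ := fun φ => ∫ t in (0 : ℝ)..π / 2, sin t * D (cos φ * sin t)
  have hH : H = fun φ => ∫ t, sin t * D (cos φ * sin t) ∂volume.restrict (Ioc 0 (π / 2)) := by
    ext φ
    exact intervalIntegral.integral_of_le (by positivity)
  have hoct := integrable_octantMeasure hDint
  have hHint : IntervalIntegrable H volume 0 (π / 2) := by
    rw [intervalIntegrable_iff_integrableOn_Ioc_of_le (by positivity), hH]
    exact hoct.integral_prod_left
  have hHval : ∫ φ in (0 : ℝ)..π / 2, H φ = π / 2 * (f q - sphereMean f q (π / 2)) := by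
    have hM : Continuous fun u => sphereMean f q (arccos u) :=
      (continuous_sphereMean hfc q).comp continuous_arccos
    have hftc := intervalIntegral.integral_eq_sub_of_hasDerivAt_of_le zero_le_one hM.continuousOn
      (fun u hu => hderiv u ⟨by linarith [hu.1], hu.2⟩) hDint
    rw [arccos_one, arccos_zero, sphereMean_zero] at hftc
    rw [← hftc, ← integral_octantMeasure hDint, intervalIntegral.integral_of_le (by positivity), hH,
      octantMeasure]
    exact (integral_prod _ hoct).symm
  have hJ : ∀ θ ∈ Ioo 0 π,
      (∫ h : S2, angleDensityDeriv f h (rotate q h) θ ∂omega2) * cos (θ / 2) = 2 * H (θ / 2) := by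
    intro θ hθ
    have h1 : 0 < cos (θ / 2) := cos_pos_of_mem_Ioo ⟨by linarith [hθ.1], by linarith [hθ.2]⟩
    have h2 : 0 < sin (θ / 2) := sin_pos_of_pos_of_lt_pi (by linarith [hθ.1]) (by linarith [hθ.2])
    have h3 : cos (θ / 2) < 1 := by nlinarith [sin_sq_add_cos_sq (θ / 2)]
    rw [(angleDensityDeriv_properties hf heven q hθ).2.2 _
      (hasDerivAt_circleSphereMean hfc hD hB0 hB hderiv h1 h3)]
    change π * (2 / π * H (θ / 2)) = _
    field_simp
  have hHint' : IntervalIntegrable (fun θ => 2 * H (θ / 2)) volume 0 π := by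
    have h := (hHint.comp_mul_left (c := 1 / 2)).const_mul 2
    rw [zero_div, show π / 2 / (1 / 2) = π by ring] at h
    exact h.congr fun θ _ => by ring_nf
  have hJ' : ∫ θ in (0 : ℝ)..π,
      (∫ h : S2, angleDensityDeriv f h (rotate q h) θ ∂omega2) * cos (θ / 2) =
        ∫ θ in (0 : ℝ)..π, 2 * H (θ / 2) := by
    rw [intervalIntegral.integral_of_le pi_pos.le, intervalIntegral.integral_of_le pi_pos.le,
      integral_Ioc_eq_integral_Ioo, integral_Ioc_eq_integral_Ioo]
    exact setIntegral_congr_fun measurableSet_Ioo hJ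
  refine ⟨fun C hC hdist => dualRadon_radon_eq_abel hfc heven q hC hdist,
    integrable_omega2 hradon,
    fun h θ hθ => (angleDensityDeriv_properties hf heven q hθ).1 h,
    fun θ hθ => integrable_omega2 (angleDensityDeriv_properties hf heven q hθ).2.1, ?_, ?_⟩
  · rw [intervalIntegrable_iff_integrableOn_Ioo_of_le pi_pos.le] at hHint' ⊢
    exact (integrableOn_congr_fun hJ measurableSet_Ioo).2 hHint'
  · rw [hJ', hradon', intervalIntegral.integral_const_mul,
      intervalIntegral.integral_comp_div _ two_ne_zero, zero_div, hHval]
    field_simp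
    ring

end
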